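/- Let $c\in\mathbb{C}$ with $\Re(c)>0$ and $\Im(c)>0$. On the form domain $V=W^{1,2}(\mathbb{R})\cap\{f\in L^2(\mathbb{R}) : \int_{\mathbb{R}} x^2|f(x)|^2\,dx<\infty\}$ consider the quadratic form $$Q_c(f,g)=\int_{\mathbb{R}} f'(x)\overline{g'(x)}\,dx+c\int_{\mathbb{R}} x^2f(x)\overline{g(x)}\,dx ,$$ and let $H_c$ (the complex harmonic oscillator $-\frac{d^2}{dx^2}+cx^2$) be the operator in $L^2(\mathbb{R})$ associated to $Q_c$: $f\in\mathrm{Dom}(H_c)$ and $H_cf=h$ if and only if $f\in V$, $h\in L^2(\mathbb{R})$ and $Q_c(f,g)=\int_{\mathbb{R}} h\,\overline{g}\,dx$ for all $g\in V$. For $\varepsilon>0$ let $$\mathrm{Spec}_\varepsilon(H_c)=\mathrm{Spec}(H_c)\cup\{z\in\mathbb{C} : \|(H_c-z)^{-1}\|\ge 1/\varepsilon\},$$ where $\mathrm{Spec}(H_c)$ is the set of $z$ for which $H_c-z$ has no bounded inverse on $L^2(\mathbb{R})$. Put $\lambda_n=c^{1/2}(2n+1)$ for $n=0,1,2,\dots$,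 with the principal square root, and $S(0,\arg c)=\{z\in\mathbb{C}\setminus\{0\} : 0<\arg z<\arg c\}$. **Theorem.** For all $0<\delta<1$ and all $m=0,1,2,\dots$ there exists $\varepsilon>0$ such that $$\mathrm{Spec}_\varepsilon(H_c)\subset\Bigl[S(0,\arg c)+(\lambda_{m+1}-\delta\,c^{1/2})\Bigr]\cup\bigcup_{n=0}^{m}\{z\in\mathbb{C} : |z-\lambda_n|<\delta\}.$$ -/

import Mathlib

open MeasureTheory
open scoped ContDiff ComplexConjugate

noncomputable section

namespace ComplexOscillator

/-- The Hilbert space `L²(ℝ)` of complex-valued functions. Mathlib's `inner ℂ f g` on it is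
`∫ conj (f x) * g x dx`, conjugate-linear in the first argument. -/
abbrev L2 : Type := Lp ℂ 2 (volume : Measure ℝ)

/-! ### Form domain and quadratic form -/

/-- `f'` is the weak (distributional) derivative of `f`: `∫ φ' f = - ∫ φ f'` for every smooth
compactly supported `φ`. -/
def IsWeakDeriv (f f' : L2) : Prop :=
  ∀ φ : ℝ → ℝ, ContDiff ℝ ∞ φ → HasCompactSupport φ →
    ∫ x, deriv φ x • f x = -∫ x, φ x • f' x

lemma locallyIntegrable_L2 (f : L2) : LocallyIntegrable f volume :=
  (Lp.memLp f).locallyIntegrable (by norm_num)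

lemma integrable_smul_L2 {φ : ℝ → ℝ} (hφ : Continuous φ) (hc : HasCompactSupport φ) (f : L2) :
    Integrable (fun x => φ x • f x) :=
  (locallyIntegrable_L2 f).integrable_smul_left_of_hasCompactSupport hφ hc

lemma integrable_deriv_smul_L2 {φ : ℝ → ℝ} (hφ : ContDiff ℝ ∞ φ) (hc : HasCompactSupport φ)
    (f : L2) : Integrable (fun x => deriv φ x • f x) :=
  integrable_smul_L2 (hφ.continuous_deriv (by simp)) hc.deriv f

/-- Pairs `(f, f')` of square integrable functions such that `f'` is the weak derivative of `f`. -/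
def weakDerivGraph : Submodule ℂ (L2 × L2) where
  carrier := {p | IsWeakDeriv p.1 p.2}
  zero_mem' := by
    intro φ _ _
    have h : ∀ u : ℝ → ℝ, ∫ x, u x • (0 : L2) x = 0 := fun u => by
      rw [integral_eq_zero_of_ae]
      filter_upwards [Lp.coeFn_zero ℂ 2 (volume : Measure ℝ)] with x hx
      rw [hx, Pi.zero_apply, smul_zero]
    simp only [Prod.fst_zero, Prod.snd_zero]
    rw [h, h, neg_zero]
  add_mem' := by
    rintro ⟨f, f'⟩ ⟨g, g'⟩ hf hg φ hφ hc
    have h : ∀ (u : ℝ → ℝ) (a b : L2), Integrable (fun x => u x • a x) →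
        Integrable (fun x => u x • b x) →
        ∫ x, u x • (a + b : L2) x = (∫ x, u x • a x) + ∫ x, u x • b x := fun u a b ha hb => by
      rw [← integral_add ha hb]
      refine integral_congr_ae ?_
      filter_upwards [Lp.coeFn_add a b] with x hx
      rw [hx, Pi.add_apply, smul_add]
    simp only [Prod.mk_add_mk]
    rw [h _ _ _ (integrable_deriv_smul_L2 hφ hc f) (integrable_deriv_smul_L2 hφ hc g),
      h _ _ _ (integrable_smul_L2 hφ.continuous hc f') (integrable_smul_L2 hφ.continuous hc g'),
      hf φ hφ hc, hg φ hφ hc]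
    ring
  smul_mem' := by
    rintro a ⟨f, f'⟩ hf φ hφ hc
    have h : ∀ (u : ℝ → ℝ) (b : L2),
        ∫ x, u x • (a • b : L2) x = a * ∫ x, u x • b x := fun u b => by
      rw [← integral_const_mul]
      refine integral_congr_ae ?_
      filter_upwards [Lp.coeFn_smul a b] with x hx
      simp [hx, mul_left_comm]
    simp only [Prod.smul_mk]
    rw [h, h, hf φ hφ hc]
    ring

lemma weakDerivGraph_functional (p : L2 × L2) (hp : p ∈ weakDerivGraph) (h0 : p.1 = 0) :
    p.2 = 0 := by
  obtain ⟨f, f'⟩ := p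
  simp only at h0 ⊢
  subst h0
  refine (Lp.eq_zero_iff_ae_eq_zero).2 ?_
  refine ae_eq_zero_of_integral_contDiff_smul_eq_zero (locallyIntegrable_L2 f') ?_
  intro φ hφ hc
  have h := hp φ hφ hc
  have h' : ∫ x, deriv φ x • (0 : L2) x = 0 := by
    rw [integral_eq_zero_of_ae]
    filter_upwards [Lp.coeFn_zero ℂ 2 (volume : Measure ℝ)] with x hx
    rw [hx, Pi.zero_apply, smul_zero]
  simp only at h
  rw [h'] at h
  exact neg_eq_zero.1 h.symm

/-- The weak derivative `f ↦ f'` as an unbounded operator in `L²(ℝ)`; its domain is the Sobolev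
space `W^{1,2}(ℝ)`. -/
def weakDeriv : L2 →ₗ.[ℂ] L2 := weakDerivGraph.toLinearPMap

lemma mem_weakDeriv_domain_iff (f : L2) :
    f ∈ weakDeriv.domain ↔ ∃ f' : L2, IsWeakDeriv f f' := by
  simp only [weakDeriv, Submodule.toLinearPMap_domain, Submodule.mem_map, LinearMap.fst_apply,
    Prod.exists, exists_and_right, exists_eq_right]
  rfl

lemma isWeakDeriv_weakDeriv (f : weakDeriv.domain) : IsWeakDeriv f (weakDeriv f) :=
  Submodule.mem_graph_toLinearPMap weakDerivGraph_functional f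

/-- The form domain `W^{1,2}(ℝ) ∩ {f ∈ L²(ℝ) : ∫ x² |f(x)|² dx < ∞}`. -/
def formDomain : Submodule ℂ L2 where
  carrier := {f | f ∈ weakDeriv.domain ∧ MemLp (fun x : ℝ => (x : ℂ) * f x) 2 volume}
  zero_mem' := by
    refine ⟨zero_mem _, (memLp_congr_ae ?_).1 (MemLp.zero (ε := ℂ))⟩
    filter_upwards [Lp.coeFn_zero ℂ 2 (volume : Measure ℝ)] with x hx
    rw [hx, Pi.zero_apply, mul_zero]
  add_mem' := by
    rintro f g ⟨hf, hf'⟩ ⟨hg, hg'⟩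
    refine ⟨add_mem hf hg, (memLp_congr_ae ?_).1 (hf'.add hg')⟩
    filter_upwards [Lp.coeFn_add f g] with x hx
    rw [hx, Pi.add_apply, Pi.add_apply, mul_add]
  smul_mem' := by
    rintro a f ⟨hf, hf'⟩
    refine ⟨Submodule.smul_mem _ a hf, (memLp_congr_ae ?_).1 (hf'.const_smul a)⟩
    filter_upwards [Lp.coeFn_smul a f] with x hx
    simp [hx, mul_left_comm]

/-- The derivative `f'` of an element of the form domain. -/
def fderivative (f : formDomain) : L2 := weakDeriv ⟨f, f.2.1⟩

/-- The quadratic form `Q_c(f, g) = ∫ f' conj(g') dx + c ∫ x² f conj(g) dx`. -/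
def quadForm (c : ℂ) (f g : formDomain) : ℂ :=
  (∫ x : ℝ, fderivative f x * conj (fderivative g x)) +
    c * ∫ x : ℝ, (x : ℂ) ^ 2 * (f : L2) x * conj ((g : L2) x)

/-- Multiplication by `x`, on the form domain. -/
def mulX (f : formDomain) : L2 := f.2.2.toLp _

lemma mulX_coe (f : formDomain) : mulX f =ᵐ[volume] fun x : ℝ => (x : ℂ) * (f : L2) x :=
  MemLp.coeFn_toLp _

lemma mulX_add (f g : formDomain) : mulX (f + g) = mulX f + mulX g := by
  apply Lp.ext
  filter_upwards [mulX_coe (f + g), mulX_coe f, mulX_coe g, Lp.coeFn_add (mulX f) (mulX g),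
    Lp.coeFn_add (f : L2) (g : L2)] with x h1 h2 h3 h4 h5
  rw [h1, h4, Pi.add_apply, h2, h3, Submodule.coe_add, h5, Pi.add_apply, mul_add]

lemma mulX_smul (a : ℂ) (f : formDomain) : mulX (a • f) = a • mulX f := by
  apply Lp.ext
  filter_upwards [mulX_coe (a • f), mulX_coe f, Lp.coeFn_smul a (mulX f),
    Lp.coeFn_smul a (f : L2)] with x h1 h2 h3 h4
  rw [h1, h3, Pi.smul_apply, h2, Submodule.coe_smul, h4, Pi.smul_apply, smul_eq_mul, smul_eq_mul,
    mul_left_comm]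

lemma fderivative_add (f g : formDomain) :
    fderivative (f + g) = fderivative f + fderivative g :=
  weakDeriv.map_add ⟨f, f.2.1⟩ ⟨g, g.2.1⟩

lemma fderivative_smul (a : ℂ) (f : formDomain) : fderivative (a • f) = a • fderivative f :=
  weakDeriv.map_smul a ⟨f, f.2.1⟩

lemma quadForm_eq_inner (c : ℂ) (f g : formDomain) :
    quadForm c f g =
      inner ℂ (fderivative g) (fderivative f) + c * inner ℂ (mulX g) (mulX f) := by
  simp only [quadForm, L2.inner_def, RCLike.inner_apply]
  congr 2
  refine integral_congr_ae ?_
  filter_upwards [mulX_coe f, mulX_coe g] with x h1 h2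
  rw [h1, h2, map_mul, Complex.conj_ofReal]
  ring

/-! ### The complex harmonic oscillator -/

/-- The graph of the operator associated to the form `Q_c`: the pairs `(f, h)` such that `f` lies
in the form domain and `Q_c(f, g) = ⟨h, g⟩_{L²}` for all `g` in the form domain. -/
def oscillatorGraph (c : ℂ) : Submodule ℂ (L2 × L2) where
  carrier := {p | ∃ hp : p.1 ∈ formDomain, ∀ g : formDomain,
    quadForm c ⟨p.1, hp⟩ g = ∫ x : ℝ, p.2 x * conj ((g : L2) x)}
  zero_mem' := by
    refine ⟨zero_mem _, fun g => ?_⟩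
    have h1 : (⟨(0 : L2 × L2).1, zero_mem _⟩ : formDomain) = (0 : ℂ) • 0 := (zero_smul ℂ (0 : formDomain)).symm
    have h2 := L2.inner_def (𝕜 := ℂ) (g : L2) (0 : L2)
    simp only [RCLike.inner_apply] at h2
    rw [h1, quadForm_eq_inner, fderivative_smul, mulX_smul, Prod.snd_zero, ← h2]
    simp
  add_mem' := by
    rintro ⟨f, h⟩ ⟨f₂, h₂⟩ ⟨hf, H⟩ ⟨hf₂, H₂⟩
    refine ⟨add_mem hf hf₂, fun g => ?_⟩
    have h1 : (⟨((f, h) + (f₂, h₂) : L2 × L2).1, add_mem hf hf₂⟩ : formDomain)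
      = ⟨f, hf⟩ + ⟨f₂, hf₂⟩ := rfl
    have h2 := fun u : L2 => L2.inner_def (𝕜 := ℂ) (g : L2) u
    simp only [RCLike.inner_apply] at h2
    have H' := H g
    have H₂' := H₂ g
    rw [← h2, quadForm_eq_inner] at H' H₂'
    rw [h1, quadForm_eq_inner, fderivative_add, mulX_add, ← h2]
    simp only [Prod.mk_add_mk, inner_add_right]
    rw [← H', ← H₂']
    ring
  smul_mem' := by
    rintro a ⟨f, h⟩ ⟨hf, H⟩
    refine ⟨Submodule.smul_mem _ a hf, fun g => ?_⟩
    have h1 : (⟨(a • (f, h) : L2 × L2).1, Submodule.smul_mem _ a hf⟩ : formDomain)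
      = a • ⟨f, hf⟩ := rfl
    have h2 := fun u : L2 => L2.inner_def (𝕜 := ℂ) (g : L2) u
    simp only [RCLike.inner_apply] at h2
    have H' := H g
    rw [← h2, quadForm_eq_inner] at H'
    rw [h1, quadForm_eq_inner, fderivative_smul, mulX_smul, ← h2]
    simp only [Prod.smul_mk, inner_smul_right]
    rw [← H']
    ring

lemma memLp_of_compactSupport {φ : ℝ → ℝ} (hφ : Continuous φ) (hc : HasCompactSupport φ) :
    MemLp (fun x => (φ x : ℂ)) 2 (volume : Measure ℝ) :=
  (Complex.continuous_ofReal.comp hφ).memLp_of_hasCompactSupport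
    (hc.comp_left (g := fun t : ℝ => (t : ℂ)) Complex.ofReal_zero)

/-- Smooth compactly supported functions belong to the form domain. -/
lemma toLp_mem_formDomain {φ : ℝ → ℝ} (hφ : ContDiff ℝ ∞ φ) (hc : HasCompactSupport φ) :
    (memLp_of_compactSupport hφ.continuous hc).toLp _ ∈ formDomain := by
  have hφ' : Continuous (deriv φ) := hφ.continuous_deriv (by simp)
  refine ⟨(mem_weakDeriv_domain_iff _).2 ⟨(memLp_of_compactSupport hφ' hc.deriv).toLp _, ?_⟩, ?_⟩
  · intro ψ hψ hψc
    have hψ' : Continuous (deriv ψ) := hψ.continuous_deriv (by simp)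
    have e1 : ∫ x, deriv ψ x • ((memLp_of_compactSupport hφ.continuous hc).toLp _ : L2) x
        = ((∫ x, deriv ψ x * φ x : ℝ) : ℂ) := by
      rw [← integral_complex_ofReal]
      refine integral_congr_ae ?_
      filter_upwards [(memLp_of_compactSupport hφ.continuous hc).coeFn_toLp] with x hx
      simp [hx]
    have e2 : ∫ x, ψ x • ((memLp_of_compactSupport hφ' hc.deriv).toLp _ : L2) x
        = ((∫ x, ψ x * deriv φ x : ℝ) : ℂ) := by
      rw [← integral_complex_ofReal]
      refine integral_congr_ae ?_
      filter_upwards [(memLp_of_compactSupport hφ' hc.deriv).coeFn_toLp] with x hx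
      simp [hx]
    rw [e1, e2, ← Complex.ofReal_neg]
    congr 1
    have key := integral_mul_deriv_eq_deriv_mul_of_integrable (u := ψ) (v := φ)
      (u' := deriv ψ) (v' := deriv φ)
      (fun x _ => (hψ.differentiable (by simp) x).hasDerivAt)
      (fun x _ => (hφ.differentiable (by simp) x).hasDerivAt)
      ((hψ.continuous.mul hφ').integrable_of_hasCompactSupport hψc.mul_right)
      ((hψ'.mul hφ.continuous).integrable_of_hasCompactSupport hψc.deriv.mul_right)
      ((hψ.continuous.mul hφ.continuous).integrable_of_hasCompactSupport hψc.mul_right)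
    rw [key, neg_neg]
  · refine (memLp_congr_ae ?_).1
      (memLp_of_compactSupport (continuous_id.mul hφ.continuous) hc.mul_left)
    filter_upwards [(memLp_of_compactSupport hφ.continuous hc).coeFn_toLp] with x hx
    simp [hx]

lemma oscillatorGraph_functional (c : ℂ) (p : L2 × L2) (hp : p ∈ oscillatorGraph c)
    (h0 : p.1 = 0) : p.2 = 0 := by
  obtain ⟨f, h⟩ := p
  simp only at h0 ⊢
  subst h0
  obtain ⟨hz, H⟩ := hp
  have hz' : (⟨(0 : L2), hz⟩ : formDomain) = (0 : ℂ) • 0 := (zero_smul ℂ (0 : formDomain)).symm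
  refine (Lp.eq_zero_iff_ae_eq_zero).2 ?_
  refine ae_eq_zero_of_integral_contDiff_smul_eq_zero (locallyIntegrable_L2 h) ?_
  intro φ hφ hc
  have H' := H ⟨_, toLp_mem_formDomain hφ hc⟩
  simp only [hz'] at H'
  rw [quadForm_eq_inner, fderivative_smul, mulX_smul] at H'
  simp only [zero_smul, inner_zero_right, mul_zero, add_zero] at H'
  rw [H']
  refine integral_congr_ae ?_
  filter_upwards [(memLp_of_compactSupport hφ.continuous hc).coeFn_toLp] with x hx
  rw [hx, Complex.conj_ofReal, mul_comm, Complex.real_smul]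

/-- The complex harmonic oscillator `H_c = -d²/dx² + c x²` in `L²(ℝ)`: the (unbounded) operator
associated to the form `Q_c`. -/
def oscillator (c : ℂ) : L2 →ₗ.[ℂ] L2 := (oscillatorGraph c).toLinearPMap

lemma oscillator_graph (c : ℂ) : (oscillator c).graph = oscillatorGraph c :=
  Submodule.toLinearPMap_graph_eq _ (oscillatorGraph_functional c)

lemma mem_oscillator_domain_iff (c : ℂ) (f : L2) :
    f ∈ (oscillator c).domain ↔ ∃ (hf : f ∈ formDomain) (h : L2), ∀ g : formDomain,
      quadForm c ⟨f, hf⟩ g = ∫ x : ℝ, h x * conj ((g : L2) x) := by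
  simp only [oscillator, Submodule.toLinearPMap_domain, Submodule.mem_map, LinearMap.fst_apply,
    Prod.exists, exists_and_right, exists_eq_right]
  exact ⟨fun ⟨h, hf, H⟩ => ⟨hf, h, H⟩, fun ⟨hf, h, H⟩ => ⟨h, hf, H⟩⟩

/-! ### Spectrum and pseudospectra of unbounded operators -/

section Resolvent

variable {E : Type*} [NormedAddCommGroup E] [NormedSpace ℂ E]

/-- The bounded operator `R` is the resolvent `(T - z)⁻¹` of the unbounded operator `T` at `z`. -/
def IsResolventAt (T : E →ₗ.[ℂ] E) (z : ℂ) (R : E →L[ℂ] E) : Prop :=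
  (∀ f : E, ∃ hf : R f ∈ T.domain, T ⟨R f, hf⟩ - z • R f = f) ∧
    ∀ f : T.domain, R (T f - z • (f : E)) = f

lemma IsResolventAt.unique {T : E →ₗ.[ℂ] E} {z : ℂ} {R R' : E →L[ℂ] E}
    (h : IsResolventAt T z R) (h' : IsResolventAt T z R') : R = R' := by
  ext f
  obtain ⟨hf, e⟩ := h'.1 f
  have := h.2 ⟨R' f, hf⟩
  rwa [e] at this

/-- The spectrum of an unbounded operator: the `z` for which `T - z` has no bounded inverse. -/
def opSpectrum (T : E →ₗ.[ℂ] E) : Set ℂ := {z | ¬ ∃ R, IsResolventAt T z R}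

/-- The `ε`-pseudospectrum `Spec T ∪ {z : ‖(T - z)⁻¹‖ ≥ 1 / ε}`. -/
def pseudospectrum (T : E →ₗ.[ℂ] E) (ε : ℝ) : Set ℂ :=
  opSpectrum T ∪ {z | ∃ R, IsResolventAt T z R ∧ 1 / ε ≤ ‖R‖}

end Resolvent

/-! ### Eigenvalues and sectors -/

/-- `λ_n = c^{1/2} (2n + 1)`, with the principal branch of the square root. -/
def eigval (c : ℂ) (n : ℕ) : ℂ := c ^ (1 / 2 : ℂ) * (2 * n + 1)

/-- The open angular sector `{z ≠ 0 : α < arg z < β}`. -/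
def sector (α β : ℝ) : Set ℂ := {z | z ≠ 0 ∧ α < z.arg ∧ z.arg < β}

end ComplexOscillator

end

/-! Write a for the principal square root of c; then Re a > 0 and Im a > 0. On functions p(x) exp(-a
x²/2) with p a polynomial, the problem becomes algebraic: H_c - z acts through `oscPoly a z`, which
is triangular on monomials with diagonal a(2n+1) - z, hence onto when z is none of the λ_n. These
functions are dense in L², so an a priori bound ‖f‖ ≤ M ‖(H_c - z) f‖ on them already produces the
resolvent, with norm at most M (`exists_isResolventAt`).

The bounds have two sources. First, the form takes values in the cone spanned by 1 and c, so if Re θ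
≥ 0 and Re (θ c) ≥ 0, the half-plane Re (θ z) ≤ -η carries the bound |θ|/η
(`norm_gauss_le_of_re_le`). Second, the lowering operator d/dx + a x is just p ↦ p', and it
intertwines H_c - z with H_c - (z - 2a). If (H_c - z) sends p to h, then p' solves the equation at z
- 2a with data h', and p is recovered by applying the raising operator a x - d/dx to p' and dividing
by a - z. So a bound at z - 2a gives one at z when |z - a| ≥ d (`norm_gauss_le_ladder`). Each
iteration moves the half-plane by 2 Re (θ a) (`exists_norm_gauss_le`). Since these half-planes are
unbounded, the constants must not grow with z.

The complement of the translated sector is the union of two half-planes, one for each edge. Both are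
reached in this way, away from λ_0, ..., λ_m, and ε is chosen so that 1/ε exceeds both bounds. -/

namespace ComplexOscillator

/-! ### Polynomials times a complex Gaussian in L². -/

section Gaussian

open Polynomial Filter Topology

/-- The function `p(x) exp(-a x² / 2)`. -/
noncomputable def gaussFun (a : ℂ) (p : ℂ[X]) (x : ℝ) : ℂ :=
  p.eval (x : ℂ) * Complex.exp (-(a / 2) * (x : ℂ) ^ 2)

/-- The action of `d/dx` on the polynomial factor of `p(x) exp(-a x² / 2)`. -/
noncomputable def dPoly (a : ℂ) (p : ℂ[X]) : ℂ[X] := derivative p - C a * X * p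

lemma hasDerivAt_gaussFun (a : ℂ) (p : ℂ[X]) (x : ℝ) :
    HasDerivAt (gaussFun a p) (gaussFun a (dPoly a p) x) x := by
  have h1 : HasDerivAt (fun z : ℂ => p.eval z * Complex.exp (-(a / 2) * z ^ 2))
      (gaussFun a (dPoly a p) x) (x : ℂ) := by
    have h2 : HasDerivAt (fun z : ℂ => -(a / 2) * z ^ 2) (-(a / 2) * (2 * (x : ℂ))) (x : ℂ) := by
      simpa using (hasDerivAt_pow 2 (x : ℂ)).const_mul (-(a / 2))
    refine ((p.hasDerivAt (x : ℂ)).mul h2.cexp).congr_deriv ?_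
    simp only [gaussFun, dPoly, eval_sub, eval_mul, eval_C, eval_X]
    ring
  exact h1.comp_ofReal

lemma contDiff_gaussFun (a : ℂ) (p : ℂ[X]) : ContDiff ℝ ∞ (gaussFun a p) := by
  have h1 : ContDiff ℂ ∞ (fun z : ℂ => p.eval z * Complex.exp (-(a / 2) * z ^ 2)) := by
    refine ContDiff.mul ?_ (ContDiff.cexp (by fun_prop))
    simpa [coe_aeval_eq_eval] using p.contDiff_aeval (𝕜 := ℂ) ∞
  exact (h1.restrict_scalars ℝ).comp Complex.ofRealCLM.contDiff

lemma continuous_gaussFun (a : ℂ) (p : ℂ[X]) : Continuous (gaussFun a p) :=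
  (contDiff_gaussFun a p).continuous

lemma gaussFun_add (a : ℂ) (p q : ℂ[X]) : gaussFun a (p + q) = gaussFun a p + gaussFun a q := by
  ext x; simp [gaussFun, add_mul]

lemma gaussFun_smul (a b : ℂ) (p : ℂ[X]) : gaussFun a (b • p) = b • gaussFun a p := by
  ext x; simp [gaussFun, mul_assoc]

lemma conj_gaussFun (a : ℂ) (p : ℂ[X]) (x : ℝ) :
    conj (gaussFun a p x) = gaussFun (conj a) (p.map (starRingEnd ℂ)) x := by
  have h : (p.map (starRingEnd ℂ)).eval (x : ℂ) = conj (p.eval (x : ℂ)) := by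
    conv_lhs => rw [← Complex.conj_ofReal x]
    rw [eval_map_apply]
  simp [gaussFun, h, ← Complex.exp_conj, map_ofNat]

lemma norm_exp_gauss (a : ℂ) (x : ℝ) :
    ‖Complex.exp (-(a / 2) * (x : ℂ) ^ 2)‖ = Real.exp (-(a.re / 2) * x ^ 2) := by
  rw [Complex.norm_exp]
  congr 1
  rw [← Complex.ofReal_pow, Complex.re_mul_ofReal]
  simp

lemma memLp_gaussFun {a : ℂ} (ha : 0 < a.re) (p : ℂ[X]) : MemLp (gaussFun a p) 2 volume := by
  induction p using Polynomial.induction_on' with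
  | add p q hp hq => rw [gaussFun_add]; exact hp.add hq
  | monomial n b =>
    rw [memLp_two_iff_integrable_sq_norm (continuous_gaussFun a _).aestronglyMeasurable]
    have h := (integrable_rpow_mul_exp_neg_mul_sq ha (s := ((2 * n : ℕ) : ℝ))
      (by have : (0 : ℝ) ≤ ((2 * n : ℕ) : ℝ) := Nat.cast_nonneg _
          linarith)).const_mul (‖b‖ ^ 2)
    refine h.congr (Eventually.of_forall fun x => ?_)
    simp only [gaussFun, eval_monomial, norm_mul, norm_exp_gauss, norm_pow, Complex.norm_real,
      Real.norm_eq_abs, mul_pow, Real.rpow_natCast]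
    rw [← Real.exp_nat_mul, ← pow_mul, mul_comm n 2, pow_mul |x|, sq_abs, pow_mul x, mul_assoc]
    congr 3
    push_cast
    ring

/-- The element `p(x) exp(-a x² / 2)` of `L²(ℝ)`. -/
noncomputable def gauss {a : ℂ} (ha : 0 < a.re) : ℂ[X] →ₗ[ℂ] L2 where
  toFun p := (memLp_gaussFun ha p).toLp _
  map_add' p q := by
    rw [← MemLp.toLp_add (memLp_gaussFun ha p) (memLp_gaussFun ha q)]
    exact MemLp.toLp_congr _ _ (by rw [gaussFun_add])
  map_smul' b p := by
    rw [RingHom.id_apply, ← MemLp.toLp_const_smul b (memLp_gaussFun ha p)]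
    exact MemLp.toLp_congr _ _ (by rw [gaussFun_smul])

lemma gauss_coe {a : ℂ} (ha : 0 < a.re) (p : ℂ[X]) : gauss ha p =ᵐ[volume] gaussFun a p :=
  (memLp_gaussFun ha p).coeFn_toLp

/-! ### Completeness of the functions `p(x) exp(-a x² / 2)` -/

/-- Completing the square: half of the Gaussian absorbs any exponential, and the other half is left
for integrability. -/
lemma exp_abs_mul_le {b : ℝ} (hb : 0 < b) (t x : ℝ) :
    Real.exp (t * |x|) * Real.exp (-b * x ^ 2) ≤
      Real.exp (t ^ 2 / (2 * b)) * Real.exp (-(b / 2) * x ^ 2) := by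
  rw [← Real.exp_add, ← Real.exp_add, Real.exp_le_exp, ← sq_abs x]
  have : t ^ 2 / (2 * b) + -(b / 2) * |x| ^ 2 - (t * |x| + -b * |x| ^ 2)
      = (t - b * |x|) ^ 2 / (2 * b) := by field_simp; ring
  have : 0 ≤ (t - b * |x|) ^ 2 / (2 * b) := by positivity
  linarith

lemma integrable_exp_abs_mul {a : ℂ} (ha : 0 < a.re) (t : ℝ) (f : L2) :
    Integrable fun x : ℝ => Real.exp (t * |x|) * Real.exp (-(a.re / 2) * x ^ 2) * ‖f x‖ := by
  have hb : 0 < a.re / 2 := by positivity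
  have h1 : MemLp (fun x : ℝ => Real.exp (-(a.re / 2 / 2) * x ^ 2)) 2 volume := by
    rw [memLp_two_iff_integrable_sq_norm (by fun_prop)]
    refine (integrable_exp_neg_mul_sq hb).congr (Eventually.of_forall fun x => ?_)
    simp only [Real.norm_eq_abs, Real.abs_exp]
    rw [← Real.exp_nat_mul]
    congr 1
    push_cast
    ring
  have h2 := (h1.integrable_mul (Lp.memLp f).norm).const_mul (Real.exp (t ^ 2 / (2 * (a.re / 2))))
  refine h2.mono' (by have := (Lp.memLp f).1.norm; fun_prop) (Eventually.of_forall fun x => ?_)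
  rw [Real.norm_of_nonneg (by positivity), Pi.mul_apply, ← mul_assoc]
  exact mul_le_mul_of_nonneg_right (exp_abs_mul_le hb t x) (norm_nonneg _)

lemma integral_exp_mul_gauss_eq_zero {a : ℂ} (ha : 0 < a.re) (f : L2)
    (hf : ∀ p : ℂ[X], ∫ x, gaussFun a p x * f x = 0) (s : ℂ) :
    ∫ x : ℝ, Complex.exp (s * x) * (gaussFun a 1 x * f x) = 0 := by
  -- Taylor sums of exp(s x): each integrates to zero by hypothesis, and exp(‖s‖ |x|) dominates them
  -- all.
  let P : ℕ → ℂ[X] := fun N => ∑ n ∈ Finset.range N, C (s ^ n / n.factorial) * X ^ n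
  have hP : ∀ N (x : ℝ), (P N).eval (x : ℂ)
      = ∑ n ∈ Finset.range N, (s * x) ^ n / n.factorial := fun N x => by
    simp only [P, eval_finsetSum, eval_mul, eval_C, eval_pow, eval_X, mul_pow]
    exact Finset.sum_congr rfl fun n _ => by ring
  have hg : ∀ N (x : ℝ), gaussFun a (P N) x = (P N).eval (x : ℂ) * gaussFun a 1 x := fun N x => by
    simp [gaussFun]
  have key := tendsto_integral_of_dominated_convergence
    (F := fun N x => gaussFun a (P N) x * f x)
    (f := fun x => Complex.exp (s * x) * (gaussFun a 1 x * f x)) _ (fun N => ?_)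
    (integrable_exp_abs_mul ha ‖s‖ f) (fun N => Eventually.of_forall fun x => ?_)
    (Eventually.of_forall fun x => ?_)
  · simp only [hf] at key
    exact (tendsto_nhds_unique key tendsto_const_nhds)
  · exact (continuous_gaussFun a _).aestronglyMeasurable.mul (Lp.memLp f).1
  · rw [norm_mul, hg, norm_mul]
    have e : ‖gaussFun a 1 x‖ = Real.exp (-(a.re / 2) * x ^ 2) := by
      simpa [gaussFun] using norm_exp_gauss a x
    rw [e]
    gcongr
    rw [hP]
    refine (norm_sum_le _ _).trans ?_
    have h3 : ∀ n, ‖(s * x) ^ n / (n.factorial : ℂ)‖ = (‖s‖ * |x|) ^ n / n.factorial :=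
      fun n => by simp
    simp only [h3]
    exact Real.sum_le_exp_of_nonneg (by positivity) N
  · simp only [hg, hP, mul_assoc]
    refine Tendsto.mul_const _ ?_
    have := (NormedSpace.expSeries_div_hasSum_exp (𝔸 := ℂ) (s * x)).tendsto_sum_nat
    rwa [← Complex.exp_eq_exp_ℂ] at this

/-- Vanishing exponential moments say that the Fourier transform of the integrable function exp(-a
x²/2) f vanishes; injectivity of the transform and the nonvanishing Gaussian give f = 0. -/
lemma eq_zero_of_integral_gauss {a : ℂ} (ha : 0 < a.re) (f : L2)
    (hf : ∀ p : ℂ[X], ∫ x, gaussFun a p x * f x = 0) : f = 0 := by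
  set F : ℝ → ℂ := fun x => gaussFun a 1 x * f x with hF
  have hFi : Integrable F := (memLp_gaussFun ha 1).integrable_mul (Lp.memLp f)
  have hFour : FourierTransform.fourier F = 0 := by
    ext w
    rw [Real.fourier_eq', Pi.zero_apply, ← integral_exp_mul_gauss_eq_zero ha f hf
      (-2 * Real.pi * w * Complex.I)]
    refine integral_congr_ae (Eventually.of_forall fun x => ?_)
    simp only [smul_eq_mul, hF]
    congr 2
    simp
    ring
  have hF0 : ∀ᵐ x, F x = 0 := by
    refine ae_eq_zero_of_integral_contDiff_smul_eq_zero hFi.locallyIntegrable ?_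
    intro φ hφ hc
    -- Every test function is the Fourier transform of a Schwartz function, so moving the transform
    -- onto F shows that F pairs to zero with it.
    let ψ : SchwartzMap ℝ ℂ := (hc.comp_left (g := fun t : ℝ => (t : ℂ))
      Complex.ofReal_zero).toSchwartzMap (Complex.ofRealCLM.contDiff.comp hφ)
    let χ : SchwartzMap ℝ ℂ := FourierTransformInv.fourierInv ψ
    have hχ : FourierTransform.fourier (χ : ℝ → ℂ) = fun x => (φ x : ℂ) := by
      rw [← SchwartzMap.fourier_coe, FourierTransform.fourier_fourierInv_eq]
      rfl
    have := VectorFourier.integral_fourierIntegral_smul_eq_flip (L := innerₗ ℝ)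
      Real.continuous_fourierChar continuous_inner (χ.integrable (μ := volume)) hFi
    have e1 : VectorFourier.fourierIntegral Real.fourierChar volume (innerₗ ℝ) (χ : ℝ → ℂ)
      = fun x => (φ x : ℂ) := hχ
    have e2 : VectorFourier.fourierIntegral Real.fourierChar volume (innerₗ ℝ) F = 0 := hFour
    rw [flip_innerₗ, e1, e2] at this
    simpa using this
  rw [Lp.eq_zero_iff_ae_eq_zero]
  filter_upwards [hF0] with x hx
  simpa [hF, gaussFun] using hx

end Gaussian

/-! ### Integration by parts -/

section IntegrationByParts

open Filter Topology

lemma integral_ofReal_smul_add_I {u v : ℝ → ℝ} {f : ℝ → ℂ} (hu : Integrable fun x => u x • f x)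
    (hv : Integrable fun x => v x • f x) :
    ∫ x, ((u x : ℂ) + v x * Complex.I) * f x
      = (∫ x, u x • f x) + Complex.I * ∫ x, v x • f x := by
  rw [← integral_const_mul, ← integral_add hu (hv.const_mul _)]
  refine integral_congr_ae (Eventually.of_forall fun x => ?_)
  simp only [Complex.real_smul]
  ring

lemma IsWeakDeriv.integral_mul_of_hasCompactSupport {f f' : L2} (h : IsWeakDeriv f f')
    {g : ℝ → ℂ} (hg : ContDiff ℝ ∞ g) (hc : HasCompactSupport g) :
    ∫ x, deriv g x * f x = -∫ x, g x * f' x := by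
  have hr : ContDiff ℝ ∞ fun x => (g x).re := Complex.reCLM.contDiff.comp hg
  have hi : ContDiff ℝ ∞ fun x => (g x).im := Complex.imCLM.contDiff.comp hg
  have hrc : HasCompactSupport fun x => (g x).re := hc.comp_left (g := Complex.re) rfl
  have hic : HasCompactSupport fun x => (g x).im := hc.comp_left (g := Complex.im) rfl
  have hd : ∀ x, HasDerivAt g (deriv g x) x := fun x =>
    (hg.differentiable (by simp) x).hasDerivAt
  have e1 : ∀ x, deriv g x = ((deriv (fun x => (g x).re) x : ℝ) : ℂ)
      + ((deriv (fun x => (g x).im) x : ℝ) : ℂ) * Complex.I := fun x => by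
    have h1 : deriv (fun x => (g x).re) x = (deriv g x).re :=
      (Complex.reCLM.hasFDerivAt.comp_hasDerivAt x (hd x)).deriv
    have h2 : deriv (fun x => (g x).im) x = (deriv g x).im :=
      (Complex.imCLM.hasFDerivAt.comp_hasDerivAt x (hd x)).deriv
    rw [h1, h2, Complex.re_add_im]
  have e3 : ∫ x, g x * f' x = ∫ x, (((g x).re : ℂ) + (g x).im * Complex.I) * f' x := by
    simp only [Complex.re_add_im]
  simp only [e1]
  rw [e3, integral_ofReal_smul_add_I (integrable_deriv_smul_L2 hr hrc f)
    (integrable_deriv_smul_L2 hi hic f), integral_ofReal_smul_add_I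
    (integrable_smul_L2 hr.continuous hrc f') (integrable_smul_L2 hi.continuous hic f'),
    h _ hr hrc, h _ hi hic]
  ring

/-- Enlarges the class of test functions so that it contains the Gaussians: cut off by χ(x/(n+1)),
whose derivative is O(1/(n+1)), and let n tend to infinity. -/
lemma IsWeakDeriv.integral_mul {f f' : L2} (h : IsWeakDeriv f f') {g g' : ℝ → ℂ}
    (hg : ContDiff ℝ ∞ g) (hd : ∀ x, HasDerivAt g (g' x) x) (hg2 : MemLp g 2 volume)
    (hg2' : MemLp g' 2 volume) : ∫ x, g' x * f x = -∫ x, g x * f' x := by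
  let χ : ContDiffBump (0 : ℝ) := ⟨1, 2, one_pos, one_lt_two⟩
  have hχ : ContDiff ℝ ∞ χ := χ.contDiff
  have hχd : ∀ x, HasDerivAt χ (deriv χ x) x := fun x =>
    (hχ.differentiable (by simp) x).hasDerivAt
  obtain ⟨K, hK⟩ := (χ.hasCompactSupport.deriv).exists_bound_of_continuous
    (hχ.continuous_deriv (by simp))
  have hpos : ∀ n : ℕ, 0 < 1 / ((n : ℝ) + 1) := fun n => Nat.one_div_pos_of_nat
  have hle : ∀ n : ℕ, 1 / ((n : ℝ) + 1) ≤ 1 := fun n => by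
    rw [div_le_one (by positivity)]; simp
  have hlim : Tendsto (fun n : ℕ => 1 / ((n : ℝ) + 1)) atTop (𝓝 0) :=
    tendsto_one_div_add_atTop_nhds_zero_nat
  let u : ℕ → ℝ → ℂ := fun n x => (χ (1 / ((n : ℝ) + 1) * x) : ℂ)
  let u' : ℕ → ℝ → ℂ := fun n x =>
    ((deriv χ (1 / ((n : ℝ) + 1) * x) * (1 / ((n : ℝ) + 1)) : ℝ) : ℂ)
  have hu : ∀ n, ContDiff ℝ ∞ (u n) := fun n =>
    Complex.ofRealCLM.contDiff.comp (hχ.comp (contDiff_const.mul contDiff_id))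
  have hud : ∀ n x, HasDerivAt (u n) (u' n x) x := fun n x => by
    have h1 : HasDerivAt (fun x : ℝ => 1 / ((n : ℝ) + 1) * x) (1 / ((n : ℝ) + 1)) x := by
      simpa using (hasDerivAt_id x).const_mul (1 / ((n : ℝ) + 1))
    exact ((hχd (1 / ((n : ℝ) + 1) * x)).comp x h1).ofReal_comp
  have hu1 : ∀ n x, ‖u n x‖ ≤ 1 := fun n x => by
    simp only [u, Complex.norm_real, Real.norm_of_nonneg χ.nonneg]
    exact χ.le_one
  have hu1' : ∀ n x, ‖u' n x‖ ≤ K * (1 / ((n : ℝ) + 1)) := fun n x => by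
    simp only [u', Complex.norm_real, norm_mul, Real.norm_of_nonneg (hpos n).le]
    exact mul_le_mul_of_nonneg_right (hK _) (hpos n).le
  have hK0 : 0 ≤ K := (norm_nonneg _).trans (hK 0)
  have hulim : ∀ x, Tendsto (fun n => u n x) atTop (𝓝 1) := fun x => by
    have h1 : Tendsto (fun n : ℕ => χ (1 / ((n : ℝ) + 1) * x)) atTop (𝓝 (χ (0 * x))) :=
      (χ.continuous.tendsto _).comp (hlim.mul_const x)
    have h2 : χ (0 * x) = 1 := by
      rw [zero_mul]; exact χ.one_of_mem_closedBall (by simp [χ])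
    rw [h2] at h1
    have h3 := (Complex.continuous_ofReal.tendsto (1 : ℝ)).comp h1
    rwa [Complex.ofReal_one] at h3
  have hulim' : ∀ x, Tendsto (fun n => u' n x) atTop (𝓝 0) := fun x => by
    refine squeeze_zero_norm (fun n => hu1' n x) ?_
    simpa using hlim.const_mul K
  have hus : ∀ n, HasCompactSupport (u n) := fun n => by
    have h1 : HasCompactSupport (fun x : ℝ => χ (1 / ((n : ℝ) + 1) * x)) :=
      χ.hasCompactSupport.comp_homeomorph (Homeomorph.mulLeft₀ _ (hpos n).ne')
    exact h1.comp_left (g := fun t : ℝ => (t : ℂ)) Complex.ofReal_zero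
  have hder : ∀ n x, deriv (fun x => u n x * g x) x = u' n x * g x + u n x * g' x := fun n x =>
    ((hud n x).mul (hd x)).deriv
  have hn : ∀ n, ∫ x, (u' n x * g x + u n x * g' x) * f x = -∫ x, u n x * (g x * f' x) :=
    fun n => by
    have := h.integral_mul_of_hasCompactSupport ((hu n).mul hg) (hus n).mul_right
    simp only [hder] at this
    simpa only [mul_assoc] using this
  have hmg := hg2.1
  have hmg' := hg2'.1
  have hmf := (Lp.memLp f).1
  have hmf' := (Lp.memLp f').1
  have hmu : ∀ n, AEStronglyMeasurable (u n) volume := fun n =>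
    (hu n).continuous.aestronglyMeasurable
  have hmu' : ∀ n, AEStronglyMeasurable (u' n) volume := fun n => by
    have : Continuous (u' n) := by
      have := hχ.continuous_deriv (by simp)
      fun_prop
    exact this.aestronglyMeasurable
  have i1 : Integrable fun x => g x * f' x := hg2.integrable_mul (Lp.memLp f')
  have i2 : Integrable fun x => g x * f x := hg2.integrable_mul (Lp.memLp f)
  have i3 : Integrable fun x => g' x * f x := hg2'.integrable_mul (Lp.memLp f)
  have L1 : Tendsto (fun n => ∫ x, u n x * (g x * f' x)) atTop (𝓝 (∫ x, g x * f' x)) := by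
    refine tendsto_integral_of_dominated_convergence (fun x => ‖g x * f' x‖)
      (fun n => (hmu n).mul i1.1) i1.norm (fun n => Eventually.of_forall fun x => ?_)
      (Eventually.of_forall fun x => ?_)
    · rw [norm_mul]
      exact mul_le_of_le_one_left (norm_nonneg _) (hu1 n x)
    · simpa using (hulim x).mul_const (g x * f' x)
  have L2 : Tendsto (fun n => ∫ x, (u' n x * g x + u n x * g' x) * f x) atTop
      (𝓝 (∫ x, g' x * f x)) := by
    refine tendsto_integral_of_dominated_convergence
      (fun x => K * ‖g x * f x‖ + ‖g' x * f x‖)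
      (fun n => (((hmu' n).mul hmg).add ((hmu n).mul hmg')).mul hmf)
      ((i2.norm.const_mul K).add i3.norm) (fun n => Eventually.of_forall fun x => ?_)
      (Eventually.of_forall fun x => ?_)
    · rw [add_mul, mul_assoc, mul_assoc]
      refine (norm_add_le _ _).trans ?_
      rw [norm_mul, norm_mul (u n x)]
      refine add_le_add (mul_le_mul_of_nonneg_right ?_ (norm_nonneg _))
        (mul_le_of_le_one_left (norm_nonneg _) (hu1 n x))
      exact (hu1' n x).trans (mul_le_of_le_one_right hK0 (hle n))
    · simpa using (((hulim' x).mul_const (g x)).add ((hulim x).mul_const (g' x))).mul_const (f x)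
  simp only [hn] at L2
  exact tendsto_nhds_unique L2 L1.neg

end IntegrationByParts

/-! ### Gaussian functions in the form domain, adjoint relations and density. -/

section GaussianForm

open Polynomial Filter Topology

lemma isWeakDeriv_gauss {a : ℂ} (ha : 0 < a.re) (p : ℂ[X]) :
    IsWeakDeriv (gauss ha p) (gauss ha (dPoly a p)) := by
  intro φ hφ hc
  have hφ' : Continuous (deriv φ) := hφ.continuous_deriv (by simp)
  have hφd : ∀ x, HasDerivAt (fun x => (φ x : ℂ)) ((deriv φ x : ℝ) : ℂ) x := fun x =>
    ((hφ.differentiable (by simp) x).hasDerivAt).ofReal_comp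
  have e : ∀ (u : ℝ → ℝ) (q : ℂ[X]), ∫ x, u x • gauss ha q x = ∫ x, (u x : ℂ) * gaussFun a q x :=
    fun u q => by
    refine integral_congr_ae ?_
    filter_upwards [gauss_coe ha q] with x hx
    rw [hx, Complex.real_smul]
  have hi : ∀ (u : ℝ → ℝ) (q : ℂ[X]), Continuous u → HasCompactSupport u →
      Integrable ((fun x => (u x : ℂ)) * gaussFun a q) := fun u q hu huc =>
    ((Complex.continuous_ofReal.comp hu).mul
      (continuous_gaussFun a q)).integrable_of_hasCompactSupport
      (huc.comp_left (g := fun t : ℝ => (t : ℂ)) Complex.ofReal_zero).mul_right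
  rw [e, e, integral_mul_deriv_eq_deriv_mul_of_integrable (u := fun x => (φ x : ℂ))
    (v := gaussFun a p) (u' := fun x => ((deriv φ x : ℝ) : ℂ)) (fun x _ => hφd x)
    (fun x _ => hasDerivAt_gaussFun a p x) (hi φ _ hφ.continuous hc)
    (hi _ p hφ' hc.deriv) (hi φ p hφ.continuous hc), neg_neg]

lemma gauss_X_mul_coe {a : ℂ} (ha : 0 < a.re) (p : ℂ[X]) :
    gauss ha (X * p) =ᵐ[volume] fun x : ℝ => (x : ℂ) * gauss ha p x := by
  filter_upwards [gauss_coe ha (X * p), gauss_coe ha p] with x h1 h2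
  rw [h1, h2, gaussFun, gaussFun, eval_mul, eval_X, mul_assoc]

lemma gauss_mem_formDomain {a : ℂ} (ha : 0 < a.re) (p : ℂ[X]) : gauss ha p ∈ formDomain :=
  ⟨(mem_weakDeriv_domain_iff _).2 ⟨_, isWeakDeriv_gauss ha p⟩,
    (memLp_congr_ae (gauss_X_mul_coe ha p)).1 (Lp.memLp _)⟩

lemma fderivative_eq_of_isWeakDeriv {f : formDomain} {f' : L2} (h : IsWeakDeriv f f') :
    fderivative f = f' := by
  have h1 : ((f : L2), fderivative f) ∈ weakDerivGraph := isWeakDeriv_weakDeriv ⟨f, f.2.1⟩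
  have h2 : ((f : L2), f') ∈ weakDerivGraph := h
  have := weakDerivGraph_functional _ (sub_mem h1 h2) (sub_self _)
  exact sub_eq_zero.1 this

lemma mulX_eq_of_coe {f : formDomain} {y : L2}
    (h : y =ᵐ[volume] fun x : ℝ => (x : ℂ) * (f : L2) x) : mulX f = y :=
  Lp.ext ((mulX_coe f).trans h.symm)

lemma isWeakDeriv_fderivative (f : formDomain) : IsWeakDeriv f (fderivative f) :=
  isWeakDeriv_weakDeriv ⟨f, f.2.1⟩

lemma conj_re_pos {a : ℂ} (ha : 0 < a.re) : 0 < (conj a).re := by simpa using ha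

lemma inner_gauss {a : ℂ} (ha : 0 < a.re) (p : ℂ[X]) (f : L2) :
    inner ℂ (gauss ha p) f = ∫ x, gaussFun (conj a) (p.map (starRingEnd ℂ)) x * f x := by
  rw [L2.inner_def]
  refine integral_congr_ae ?_
  filter_upwards [gauss_coe ha p] with x hx
  rw [RCLike.inner_apply, hx, conj_gaussFun, mul_comm]

lemma map_dPoly (a : ℂ) (p : ℂ[X]) :
    (dPoly a p).map (starRingEnd ℂ) = dPoly (conj a) (p.map (starRingEnd ℂ)) := by
  simp [dPoly, derivative_map]

lemma inner_gauss_dPoly {a : ℂ} (ha : 0 < a.re) (p : ℂ[X]) {f f' : L2} (h : IsWeakDeriv f f') :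
    inner ℂ (gauss ha (dPoly a p)) f = -inner ℂ (gauss ha p) f' := by
  rw [inner_gauss, inner_gauss, map_dPoly]
  exact h.integral_mul (contDiff_gaussFun _ _) (hasDerivAt_gaussFun _ _)
    (memLp_gaussFun (conj_re_pos ha) _) (memLp_gaussFun (conj_re_pos ha) _)

lemma inner_gauss_X_mul {a : ℂ} (ha : 0 < a.re) (p : ℂ[X]) {f y : L2}
    (h : y =ᵐ[volume] fun x : ℝ => (x : ℂ) * f x) :
    inner ℂ (gauss ha (X * p)) f = inner ℂ (gauss ha p) y := by
  rw [inner_gauss, inner_gauss]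
  refine integral_congr_ae ?_
  filter_upwards [h] with x hx
  rw [hx, Polynomial.map_mul, Polynomial.map_X, gaussFun, gaussFun, eval_mul, eval_X]
  ring

lemma norm_gauss_conj {a : ℂ} (ha : 0 < a.re) (p : ℂ[X]) :
    ‖gauss (conj_re_pos ha) (p.map (starRingEnd ℂ))‖ = ‖gauss ha p‖ := by
  rw [Lp.norm_def, Lp.norm_def]
  congr 1
  refine eLpNorm_congr_norm_ae ?_
  filter_upwards [gauss_coe ha p, gauss_coe (conj_re_pos ha) (p.map (starRingEnd ℂ))] with x h1 h2
  rw [h1, h2, ← conj_gaussFun, RCLike.norm_conj]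

lemma map_conj_map_conj (p : ℂ[X]) : (p.map (starRingEnd ℂ)).map (starRingEnd ℂ) = p := by
  ext n; simp

lemma inner_gauss_conj_comm {a : ℂ} (ha : 0 < a.re) (p q : ℂ[X]) :
    inner ℂ (gauss (conj_re_pos ha) (p.map (starRingEnd ℂ))) (gauss ha q)
      = inner ℂ (gauss (conj_re_pos ha) (q.map (starRingEnd ℂ))) (gauss ha p) := by
  rw [inner_gauss, inner_gauss, map_conj_map_conj, map_conj_map_conj, Complex.conj_conj]
  refine integral_congr_ae ?_
  filter_upwards [gauss_coe ha p, gauss_coe ha q] with x h1 h2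
  rw [h1, h2, mul_comm]

lemma dense_range_gauss {a : ℂ} (ha : 0 < a.re) :
    Dense (LinearMap.range (gauss ha) : Set L2) := by
  rw [Submodule.dense_iff_topologicalClosure_eq_top, Submodule.topologicalClosure_eq_top_iff,
    Submodule.eq_bot_iff]
  intro f hf
  refine eq_zero_of_integral_gauss (conj_re_pos ha) f fun p => ?_
  have := (Submodule.mem_orthogonal _ _).1 hf _ ⟨p.map (starRingEnd ℂ), rfl⟩
  rwa [inner_gauss, map_conj_map_conj] at this

/-- By density the inequality extends to all of L², where it can be tested on f itself. -/
lemma norm_le_of_forall_inner_gauss {a : ℂ} (ha : 0 < a.re) {f : L2} {K : ℝ}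
    (hK : 0 ≤ K) (h : ∀ p, ‖inner ℂ (gauss ha p) f‖ ≤ K * ‖gauss ha p‖) : ‖f‖ ≤ K := by
  have hcl : IsClosed {g : L2 | ‖inner ℂ g f‖ ≤ K * ‖g‖} :=
    isClosed_le (by fun_prop) (by fun_prop)
  have hall : ∀ g : L2, ‖inner ℂ g f‖ ≤ K * ‖g‖ := fun g => by
    refine closure_minimal ?_ hcl ((dense_range_gauss ha) g)
    rintro _ ⟨p, rfl⟩
    exact h p
  rcases eq_or_ne f 0 with rfl | hf
  · rwa [norm_zero]
  · have := hall f
    rw [inner_self_eq_norm_sq_to_K] at this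
    simp only [norm_pow, RCLike.norm_ofReal, abs_norm] at this
    have hf' := norm_pos_iff.2 hf
    nlinarith

/-! ### The action of the oscillator on the polynomial factor -/

/-- The operator `-d²/dx² + a² x² - z` acts on `p(x) exp(-a x² / 2)` through
`p ↦ -p'' + 2 a x p' + (a - z) p`. -/
noncomputable def oscPoly (a z : ℂ) : ℂ[X] →ₗ[ℂ] ℂ[X] :=
  -(derivative ∘ₗ derivative) + (2 * a) • (LinearMap.mulLeft ℂ X ∘ₗ derivative)
    + (a - z) • LinearMap.id

lemma oscPoly_apply (a z : ℂ) (p : ℂ[X]) :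
    oscPoly a z p = -derivative (derivative p) + (2 * a) • (X * derivative p) + (a - z) • p := by
  simp [oscPoly]

lemma oscPoly_eq (a z : ℂ) (p : ℂ[X]) :
    oscPoly a z p = -dPoly a (dPoly a p) + a ^ 2 • (X * (X * p)) - z • p := by
  simp only [oscPoly_apply, dPoly, smul_eq_C_mul, derivative_sub, derivative_mul, derivative_C,
    derivative_X, C_mul, C_sub, C_pow, C_ofNat]
  ring

/-- The commutation relation behind the ladder: differentiating p lowers the spectral parameter by
2a. -/
lemma derivative_oscPoly (a z : ℂ) (p : ℂ[X]) :
    derivative (oscPoly a z p) = oscPoly a (z - 2 * a) (derivative p) := by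
  simp only [oscPoly_apply, smul_eq_C_mul, derivative_mul, derivative_C, derivative_neg,
    derivative_X, C_mul, C_sub, C_ofNat, derivative_add]
  simp
  ring

/-- The factorisation H - z = A⁺A + (a - z), where A is p ↦ p' and A⁺ = a x - d/dx. -/
lemma oscPoly_eq_ladder (a z : ℂ) (p : ℂ[X]) :
    oscPoly a z p = (a • (X * derivative p) - dPoly a (derivative p)) + (a - z) • p := by
  simp only [oscPoly_apply, dPoly, smul_eq_C_mul, C_mul, C_sub, C_ofNat]
  ring

lemma derivative_eq_ladder (a : ℂ) (p : ℂ[X]) : derivative p = dPoly a p + a • (X * p) := by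
  simp only [dPoly, smul_eq_C_mul]
  ring

lemma oscPoly_X_pow (a z : ℂ) (n : ℕ) :
    oscPoly a z (X ^ n) = (a * (2 * n + 1) - z) • X ^ n - ((n : ℂ) * (n - 1)) • X ^ (n - 2) := by
  rcases n with _ | _ | n
  · simp [oscPoly_apply]
  · simp [oscPoly_apply, smul_eq_C_mul]; ring
  · simp [oscPoly_apply, smul_eq_C_mul]; ring

/-- Triangularity: X ^ n is hit up to a multiple of X ^ (n - 2), with a nonzero diagonal
coefficient, so strong induction applies. -/
lemma oscPoly_surjective {a z : ℂ} (h : ∀ n : ℕ, z ≠ a * (2 * n + 1)) :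
    Function.Surjective (oscPoly a z) := by
  have hX : ∀ n : ℕ, X ^ n ∈ LinearMap.range (oscPoly a z) := fun n => by
    induction n using Nat.strong_induction_on with
    | _ n ih =>
      have h0 : a * (2 * n + 1) - z ≠ 0 := sub_ne_zero.2 (h n).symm
      have h1 : ((n : ℂ) * (n - 1)) • (X : ℂ[X]) ^ (n - 2) ∈ LinearMap.range (oscPoly a z) := by
        rcases n with _ | _ | n
        · simp
        · simp
        · exact Submodule.smul_mem _ _ (ih _ (by omega))
      have h2 := add_mem (LinearMap.mem_range_self (oscPoly a z) (X ^ n)) h1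
      rw [oscPoly_X_pow, sub_add_cancel] at h2
      simpa [smul_smul, inv_mul_cancel₀ h0] using
        Submodule.smul_mem _ (a * (2 * n + 1) - z)⁻¹ h2
  intro p
  change p ∈ LinearMap.range (oscPoly a z)
  induction p using Polynomial.induction_on' with
  | add p q hp hq => exact add_mem hp hq
  | monomial n b =>
    rw [← smul_X_eq_monomial]
    exact Submodule.smul_mem _ _ (hX n)

end GaussianForm

/-! ### Estimates for the oscillator on the functions `p(x) exp(-a x² / 2)` -/

section Estimates

open Polynomial

variable {a : ℂ}

/-- The square root of `‖f'‖² + ‖x f‖²` for `f = p(x) exp(-a x² / 2)`. -/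
noncomputable def energyNorm (ha : 0 < a.re) (p : ℂ[X]) : ℝ :=
  √(‖gauss ha (dPoly a p)‖ ^ 2 + ‖gauss ha (X * p)‖ ^ 2)

lemma energyNorm_nonneg (ha : 0 < a.re) (p : ℂ[X]) : 0 ≤ energyNorm ha p := Real.sqrt_nonneg _

lemma energyNorm_sq (ha : 0 < a.re) (p : ℂ[X]) :
    energyNorm ha p ^ 2 = ‖gauss ha (dPoly a p)‖ ^ 2 + ‖gauss ha (X * p)‖ ^ 2 :=
  Real.sq_sqrt (by positivity)

lemma norm_gauss_dPoly_le (ha : 0 < a.re) (p : ℂ[X]) :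
    ‖gauss ha (dPoly a p)‖ ≤ energyNorm ha p :=
  Real.le_sqrt_of_sq_le (le_add_of_nonneg_right (sq_nonneg _))

lemma norm_gauss_X_mul_le (ha : 0 < a.re) (p : ℂ[X]) :
    ‖gauss ha (X * p)‖ ≤ energyNorm ha p :=
  Real.le_sqrt_of_sq_le (le_add_of_nonneg_left (sq_nonneg _))

lemma norm_gauss_raising_le (ha : 0 < a.re) (p : ℂ[X]) :
    ‖gauss ha (a • (X * p) - dPoly a p)‖ ≤ (1 + ‖a‖) * energyNorm ha p := by
  rw [map_sub, map_smul]
  refine (norm_sub_le _ _).trans ?_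
  rw [norm_smul]
  nlinarith [norm_gauss_dPoly_le ha p, norm_gauss_X_mul_le ha p, norm_nonneg a]

lemma inner_gauss_oscPoly (ha : 0 < a.re) (z : ℂ) (p : ℂ[X]) :
    inner ℂ (gauss ha p) (gauss ha (oscPoly a z p))
      = ((‖gauss ha (dPoly a p)‖ ^ 2 : ℝ) : ℂ) + a ^ 2 * ((‖gauss ha (X * p)‖ ^ 2 : ℝ) : ℂ)
        - z * ((‖gauss ha p‖ ^ 2 : ℝ) : ℂ) := by
  have h1 := inner_gauss_dPoly ha p (isWeakDeriv_gauss ha (dPoly a p))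
  have h2 := inner_gauss_X_mul ha p (gauss_X_mul_coe ha (X * p))
  rw [oscPoly_eq, map_sub, map_add, map_neg, map_smul, map_smul, inner_sub_right,
    inner_add_right, inner_neg_right, inner_smul_right, inner_smul_right, ← h1, ← h2]
  simp [inner_self_eq_norm_sq_to_K]

lemma norm_inner_gauss_le (ha : 0 < a.re) (p q : ℂ[X]) :
    ‖inner ℂ (gauss ha p) (gauss ha q)‖ ≤ ‖gauss ha p‖ * ‖gauss ha q‖ := norm_inner_le_norm _ _

/-- Real part of the form identity. Coercivity comes from κ ≤ 1 and κ ≤ Re (a ^ 2), which control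
the two halves of the energy. -/
lemma energyNorm_sq_le (ha : 0 < a.re) {κ : ℝ} (hκ1 : κ ≤ 1) (hκ2 : κ ≤ (a ^ 2).re)
    (z : ℂ) (p : ℂ[X]) :
    κ * energyNorm ha p ^ 2 ≤ ‖z‖ * ‖gauss ha p‖ ^ 2
      + ‖inner ℂ (gauss ha p) (gauss ha (oscPoly a z p))‖ := by
  have h1 := Complex.re_le_norm (inner ℂ (gauss ha p) (gauss ha (oscPoly a z p)))
  have h2 := congrArg Complex.re (inner_gauss_oscPoly ha z p)
  rw [Complex.sub_re, Complex.add_re, Complex.ofReal_re, Complex.re_mul_ofReal,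
    Complex.re_mul_ofReal] at h2
  have h3 := mul_le_mul_of_nonneg_right (Complex.re_le_norm z) (sq_nonneg ‖gauss ha p‖)
  rw [energyNorm_sq]
  nlinarith [sq_nonneg ‖gauss ha (dPoly a p)‖, sq_nonneg ‖gauss ha (X * p)‖]

/-- The numerical range estimate. -/
lemma norm_gauss_le_of_re_le (ha : 0 < a.re) {θ z : ℂ} {η : ℝ} (hη : 0 < η) (hθ : 0 ≤ θ.re)
    (hθa : 0 ≤ (θ * a ^ 2).re) (hz : (θ * z).re ≤ -η) (p : ℂ[X]) :
    ‖gauss ha p‖ ≤ ‖θ‖ / η * ‖gauss ha (oscPoly a z p)‖ := by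
  have h1 := (Complex.re_le_norm (θ * inner ℂ (gauss ha p) (gauss ha (oscPoly a z p)))).trans
    ((norm_mul_le _ _).trans (mul_le_mul_of_nonneg_left (norm_inner_gauss_le ha p _)
      (norm_nonneg θ)))
  have h2 := congrArg (fun t => (θ * t).re) (inner_gauss_oscPoly ha z p)
  simp only [mul_sub, mul_add, ← mul_assoc] at h2
  rw [Complex.sub_re, Complex.add_re, Complex.re_mul_ofReal, Complex.re_mul_ofReal,
    Complex.re_mul_ofReal] at h2
  rcases (norm_nonneg (gauss ha p)).eq_or_lt with h0 | h0
  · rw [← h0]; positivity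
  · have h3 : η * ‖gauss ha p‖ ^ 2 ≤ ‖θ‖ * (‖gauss ha p‖ * ‖gauss ha (oscPoly a z p)‖) := by
      nlinarith [mul_nonneg hθ (sq_nonneg ‖gauss ha (dPoly a p)‖),
        mul_nonneg hθa (sq_nonneg ‖gauss ha (X * p)‖),
        mul_le_mul_of_nonneg_right hz (sq_nonneg ‖gauss ha p‖)]
    rw [div_mul_eq_mul_div, le_div_iff₀ hη]
    refine le_of_mul_le_mul_left ?_ h0
    linarith

/-! ### Duality for the bilinear pairing and the ladder step. -/

/-- The bilinear pairing `∫ f g`. -/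
noncomputable def pairing (ha : 0 < a.re) (p q : ℂ[X]) : ℂ :=
  inner ℂ (gauss (conj_re_pos ha) (p.map (starRingEnd ℂ))) (gauss ha q)

lemma norm_pairing_le (ha : 0 < a.re) (p q : ℂ[X]) :
    ‖pairing ha p q‖ ≤ ‖gauss ha p‖ * ‖gauss ha q‖ := by
  rw [← norm_gauss_conj ha p]
  exact norm_inner_le_norm _ _

lemma pairing_comm (ha : 0 < a.re) (p q : ℂ[X]) : pairing ha p q = pairing ha q p :=
  inner_gauss_conj_comm ha p q

lemma pairing_dPoly (ha : 0 < a.re) (p q : ℂ[X]) :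
    pairing ha (dPoly a p) q = -pairing ha p (dPoly a q) := by
  rw [pairing, map_dPoly]
  exact inner_gauss_dPoly (conj_re_pos ha) _ (isWeakDeriv_gauss ha q)

lemma pairing_X_mul (ha : 0 < a.re) (p q : ℂ[X]) :
    pairing ha (X * p) q = pairing ha p (X * q) := by
  rw [pairing, Polynomial.map_mul, Polynomial.map_X]
  exact inner_gauss_X_mul (conj_re_pos ha) _ (gauss_X_mul_coe ha q)

lemma pairing_add_right (ha : 0 < a.re) (p q r : ℂ[X]) :
    pairing ha p (q + r) = pairing ha p q + pairing ha p r := by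
  rw [pairing, map_add, inner_add_right]; rfl

lemma pairing_smul_right (ha : 0 < a.re) (b : ℂ) (p q : ℂ[X]) :
    pairing ha p (b • q) = b * pairing ha p q := by
  rw [pairing, map_smul, inner_smul_right]; rfl

/-- The transpose of the lowering operator is the raising operator. -/
lemma pairing_derivative (ha : 0 < a.re) (p q : ℂ[X]) :
    pairing ha p (derivative q) = pairing ha (a • (X * p) - dPoly a p) q := by
  rw [pairing_comm ha _ q, sub_eq_add_neg, pairing_add_right, ← neg_one_smul ℂ (dPoly a p),
    pairing_smul_right, pairing_smul_right, derivative_eq_ladder a, pairing_add_right,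
    pairing_smul_right, pairing_comm ha q (dPoly a p), pairing_comm ha q (X * p),
    pairing_X_mul, pairing_dPoly]
  ring

/-- H is complex symmetric: without conjugation it equals its own transpose, so no estimate for a
separate adjoint problem is needed. -/
lemma pairing_oscPoly (ha : 0 < a.re) (z : ℂ) (p q : ℂ[X]) :
    pairing ha (oscPoly a z p) q = pairing ha p (oscPoly a z q) := by
  have h : ∀ p q, pairing ha p (oscPoly a z q) = pairing ha (dPoly a p) (dPoly a q)
      + a ^ 2 * pairing ha (X * p) (X * q) - z * pairing ha p q := fun p q => by
    rw [oscPoly_eq, sub_eq_add_neg, pairing_add_right, pairing_add_right,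
      ← neg_one_smul ℂ (dPoly a _), ← neg_smul, pairing_smul_right, pairing_smul_right,
      pairing_smul_right, pairing_dPoly, pairing_X_mul]
    ring
  rw [pairing_comm, h, h, pairing_comm ha (dPoly a q), pairing_comm ha (X * q),
    pairing_comm ha q]

/-- A bound for the inverse of `oscPoly a w` bounds its inverse as a map into the energy space. -/
lemma energyNorm_le (ha : 0 < a.re) {κ : ℝ} (hκ : 0 < κ) (hκ1 : κ ≤ 1)
    (hκ2 : κ ≤ (a ^ 2).re) {w : ℂ} {M : ℝ}
    (hM : ∀ q, ‖gauss ha q‖ ≤ M * ‖gauss ha (oscPoly a w q)‖) (hM0 : 0 ≤ M) (q : ℂ[X]) :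
    energyNorm ha q ≤ √((‖w‖ * M ^ 2 + M) / κ) * ‖gauss ha (oscPoly a w q)‖ := by
  refine (sq_le_sq₀ (energyNorm_nonneg ha q) (by positivity)).1 ?_
  rw [mul_pow, Real.sq_sqrt (by positivity), div_mul_eq_mul_div, le_div_iff₀ hκ, mul_comm]
  refine (energyNorm_sq_le ha hκ1 hκ2 w q).trans ?_
  have h1 := norm_inner_gauss_le ha q (oscPoly a w q)
  have h2 := hM q
  have h3 : ‖gauss ha q‖ ^ 2 ≤ (M * ‖gauss ha (oscPoly a w q)‖) ^ 2 := by gcongr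
  have h4 := mul_le_mul_of_nonneg_left h3 (norm_nonneg w)
  have h5 := mul_le_mul_of_nonneg_right h2 (norm_nonneg (gauss ha (oscPoly a w q)))
  nlinarith

/-- Duality: the derivative on the data h is transposed onto the solution q of the equation with the
test function as data, and the energy bound for q pays for it. Hence only ‖h‖ enters, not the norm
of its derivative. -/
lemma norm_gauss_le_of_oscPoly_eq_derivative (ha : 0 < a.re) {κ : ℝ} (hκ : 0 < κ) (hκ1 : κ ≤ 1)
    (hκ2 : κ ≤ (a ^ 2).re) {w : ℂ} {M : ℝ}
    (hM : ∀ q, ‖gauss ha q‖ ≤ M * ‖gauss ha (oscPoly a w q)‖) (hM0 : 0 ≤ M)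
    (hw : Function.Surjective (oscPoly a w)) {u h : ℂ[X]} (hu : oscPoly a w u = derivative h) :
    ‖gauss ha u‖ ≤ (1 + ‖a‖) * √((‖w‖ * M ^ 2 + M) / κ) * ‖gauss ha h‖ := by
  refine norm_le_of_forall_inner_gauss (conj_re_pos ha) (by positivity) fun p => ?_
  obtain ⟨q, hq⟩ := hw (p.map (starRingEnd ℂ))
  have h1 : inner ℂ (gauss (conj_re_pos ha) p) (gauss ha u)
      = pairing ha (a • (X * q) - dPoly a q) h := by
    rw [← pairing_derivative, ← hu, ← pairing_oscPoly, hq, pairing, map_conj_map_conj]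
  have h2 : ‖gauss (conj_re_pos ha) p‖ = ‖gauss ha (oscPoly a w q)‖ := by
    rw [hq, ← norm_gauss_conj ha, map_conj_map_conj]
  rw [h1, h2]
  refine (norm_pairing_le ha _ _).trans ?_
  have h3 := (norm_gauss_raising_le ha q).trans (mul_le_mul_of_nonneg_left
    (energyNorm_le ha hκ hκ1 hκ2 hM hM0 q) (by positivity))
  refine (mul_le_mul_of_nonneg_right h3 (norm_nonneg _)).trans (le_of_eq ?_)
  ring

/-- Pairing the equation with u and integrating by parts moves the derivative off h, giving a
quadratic inequality for the energy. The point is growth only linear in ‖w‖, which the factor ‖z -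
a‖ in the ladder step can absorb. -/
lemma energyNorm_le_of_oscPoly_eq_derivative (ha : 0 < a.re) {κ : ℝ} (hκ : 0 < κ) (hκ1 : κ ≤ 1)
    (hκ2 : κ ≤ (a ^ 2).re) {w : ℂ} {M : ℝ}
    (hM : ∀ q, ‖gauss ha q‖ ≤ M * ‖gauss ha (oscPoly a w q)‖) (hM1 : 1 ≤ M)
    (hw : Function.Surjective (oscPoly a w)) {u h : ℂ[X]} (hu : oscPoly a w u = derivative h) :
    energyNorm ha u ≤ 3 * (1 + ‖a‖) * M / κ * (1 + ‖w‖) * ‖gauss ha h‖ := by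
  have hM0 : 0 ≤ M := zero_le_one.trans hM1
  set N := ‖gauss ha h‖
  set e := energyNorm ha u
  set b := 1 + ‖a‖
  have hb : 1 ≤ b := le_add_of_nonneg_right (norm_nonneg a)
  have h1 := norm_gauss_le_of_oscPoly_eq_derivative ha hκ hκ1 hκ2 hM hM0 hw hu
  have h2 : ‖gauss ha u‖ ^ 2 ≤ b ^ 2 * ((‖w‖ * M ^ 2 + M) / κ) * N ^ 2 := by
    have := pow_le_pow_left₀ (norm_nonneg _) h1 2
    rwa [mul_pow, mul_pow, Real.sq_sqrt (by positivity)] at this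
  have h3 := energyNorm_sq_le ha hκ1 hκ2 w u
  have h4 : ‖inner ℂ (gauss ha u) (gauss ha (oscPoly a w u))‖ ≤ b * e * N := by
    rw [hu, derivative_eq_ladder a, map_add, map_smul, inner_add_right, inner_smul_right,
      ← inner_gauss_X_mul ha u (gauss_X_mul_coe ha h)]
    have h5 := inner_gauss_dPoly ha u (isWeakDeriv_gauss ha h)
    rw [← neg_eq_iff_eq_neg] at h5
    rw [← h5]
    refine (norm_add_le _ _).trans ?_
    rw [norm_neg, norm_mul]
    have h6 := (norm_inner_gauss_le ha (dPoly a u) h).trans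
      (mul_le_mul_of_nonneg_right (norm_gauss_dPoly_le ha u) (norm_nonneg _))
    have h7 := (norm_inner_gauss_le ha (X * u) h).trans
      (mul_le_mul_of_nonneg_right (norm_gauss_X_mul_le ha u) (norm_nonneg _))
    have h8 := mul_le_mul_of_nonneg_left h7 (norm_nonneg a)
    calc _ ≤ e * N + ‖a‖ * (e * N) := add_le_add h6 h8
      _ = b * e * N := by simp only [b]; ring
  have hN : 0 ≤ N := norm_nonneg _
  have he : 0 ≤ e := energyNorm_nonneg ha u
  set W := 1 + ‖w‖
  have hW : 1 ≤ W := le_add_of_nonneg_right (norm_nonneg w)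
  have hwW : ‖w‖ ≤ W := le_add_of_nonneg_left zero_le_one
  -- Here M ≥ 1 gives M ≤ M ^ 2, so both terms fit under W * M ^ 2.
  have h9 : ‖w‖ * ‖gauss ha u‖ ^ 2 ≤ W * (b ^ 2 * (W * M ^ 2 / κ) * N ^ 2) := by
    refine mul_le_mul hwW (h2.trans ?_) (by positivity) (by positivity)
    gcongr
    simp only [W]
    nlinarith
  set T := b * M / κ * W * N with hT
  have hT0 : 0 ≤ T := by positivity
  have h10 : κ * e ^ 2 ≤ κ * (T ^ 2 + T * e) := by
    have i1 : W * (b ^ 2 * (W * M ^ 2 / κ) * N ^ 2) = κ * T ^ 2 := by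
      rw [hT]; field_simp
    have i2 : b * e * N ≤ κ * (T * e) := by
      have : κ * (T * e) = M * W * (b * e * N) := by rw [hT]; field_simp
      rw [this]
      refine le_mul_of_one_le_left (by positivity) ?_
      nlinarith
    nlinarith
  have h11 := le_of_mul_le_mul_left h10 hκ
  -- From e ^ 2 ≤ T ^ 2 + T * e; the factor 3 is not sharp.
  have h12 : e ≤ 3 * T := by
    by_contra hcon
    push Not at hcon
    nlinarith
  calc e ≤ 3 * T := h12
    _ = _ := by rw [hT]; ring

/-- One ladder step: a resolvent bound at `z - 2 a` gives one at `z`. -/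
lemma norm_gauss_le_ladder (ha : 0 < a.re) {κ : ℝ} (hκ : 0 < κ) (hκ1 : κ ≤ 1)
    (hκ2 : κ ≤ (a ^ 2).re) {z : ℂ} {M : ℝ}
    (hM : ∀ q, ‖gauss ha q‖ ≤ M * ‖gauss ha (oscPoly a (z - 2 * a) q)‖) (hM1 : 1 ≤ M)
    (hw : Function.Surjective (oscPoly a (z - 2 * a))) {d : ℝ} (hd : 0 < d) (hz : d ≤ ‖z - a‖)
    (p : ℂ[X]) :
    ‖gauss ha p‖ ≤ (1 / d + 3 * (1 + ‖a‖) ^ 2 * M / κ * (1 + (1 + ‖a‖) / d))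
      * ‖gauss ha (oscPoly a z p)‖ := by
  set h := oscPoly a z p with hh
  have h1 : (a - z) • p = h - (a • (X * derivative p) - dPoly a (derivative p)) := by
    rw [hh, oscPoly_eq_ladder]; ring
  have h2 : ‖z - a‖ * ‖gauss ha p‖ = ‖gauss ha ((a - z) • p)‖ := by
    rw [map_smul, norm_smul, norm_sub_rev]
  have h3 := energyNorm_le_of_oscPoly_eq_derivative ha hκ hκ1 hκ2 hM hM1 hw
    (derivative_oscPoly a z p).symm
  rw [← hh] at h3
  have h4 : ‖z - a‖ * ‖gauss ha p‖
      ≤ ‖gauss ha h‖ + (1 + ‖a‖) * (3 * (1 + ‖a‖) * M / κ * (1 + ‖z - 2 * a‖) * ‖gauss ha h‖) := by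
    rw [h2, h1, map_sub]
    refine (norm_sub_le _ _).trans (add_le_add_right ((norm_gauss_raising_le ha _).trans ?_) _)
    exact mul_le_mul_of_nonneg_left h3 (by positivity)
  -- The growth in z is at most a multiple of ‖z - a‖, so dividing by ‖z - a‖ leaves a bound
  -- independent of z.
  have h5 : 1 + ‖z - 2 * a‖ ≤ ‖z - a‖ * (1 + (1 + ‖a‖) / d) := by
    have i1 : ‖z - 2 * a‖ ≤ ‖z - a‖ + ‖a‖ := by
      rw [show z - 2 * a = (z - a) - a by ring]; exact norm_sub_le _ _
    have i2 : 1 + ‖a‖ ≤ ‖z - a‖ * ((1 + ‖a‖) / d) := by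
      rw [mul_div_assoc', le_div_iff₀ hd, mul_comm]
      gcongr
    linarith
  have h6 : 1 ≤ ‖z - a‖ * (1 / d) := by
    rw [mul_one_div, le_div_iff₀ hd, one_mul]; exact hz
  have hza : 0 < ‖z - a‖ := hd.trans_le hz
  refine le_of_mul_le_mul_left (h4.trans ?_) hza
  have hM0 : 0 ≤ M := zero_le_one.trans hM1
  have h7 := mul_le_mul_of_nonneg_left h5
    (show 0 ≤ 3 * (1 + ‖a‖) ^ 2 * M / κ * ‖gauss ha h‖ by positivity)
  have h8 := mul_le_mul_of_nonneg_right h6 (norm_nonneg (gauss ha h))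
  calc _ = 1 * ‖gauss ha h‖ + 3 * (1 + ‖a‖) ^ 2 * M / κ * ‖gauss ha h‖ * (1 + ‖z - 2 * a‖) := by
        ring
    _ ≤ _ := add_le_add h8 h7
    _ = _ := by ring

/-- A uniform resolvent bound in the half plane `re (θ z) ≤ (2 k - 1 - d) re (θ a)`, away from
the eigenvalues `a (2 n + 1)`. -/
lemma exists_norm_gauss_le (ha : 0 < a.re) (ha2 : 0 < (a ^ 2).re) {θ : ℂ} (hθ : 0 ≤ θ.re)
    (hθa2 : 0 ≤ (θ * a ^ 2).re) (hθa : 0 < (θ * a).re) {d : ℝ} (hd : 0 < d) (k : ℕ) :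
    ∃ M : ℝ, 1 ≤ M ∧ ∀ z : ℂ, (θ * z).re ≤ (2 * k - 1 - d) * (θ * a).re →
      (∀ n < k, d ≤ ‖z - a * (2 * n + 1)‖) →
      Function.Surjective (oscPoly a z) ∧
        ∀ p, ‖gauss ha p‖ ≤ M * ‖gauss ha (oscPoly a z p)‖ := by
  have hsurj : ∀ (k : ℕ) (z : ℂ), (θ * z).re ≤ (2 * k - 1 - d) * (θ * a).re →
      (∀ n < k, d ≤ ‖z - a * (2 * n + 1)‖) → Function.Surjective (oscPoly a z) := by
    intro k z hz hn
    refine oscPoly_surjective fun n hzn => ?_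
    rcases lt_or_ge n k with h | h
    · have := hn n h
      rw [hzn, sub_self, norm_zero] at this
      linarith
    · have e : (θ * z).re = (2 * n + 1) * (θ * a).re := by
        rw [hzn, ← mul_assoc]
        have : (2 * (n : ℂ) + 1) = ((2 * n + 1 : ℝ) : ℂ) := by push_cast; ring
        rw [this, Complex.re_mul_ofReal, mul_comm]
      rw [e] at hz
      have h1 := le_of_mul_le_mul_right hz hθa
      have h2 : (k : ℝ) ≤ n := by exact_mod_cast h
      linarith
  induction k with
  | zero =>
    -- For k = 0 the half-plane is Re (θ z) ≤ -(1 + d) Re (θ a), outside the numerical range, and no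
    -- eigenvalue has to be avoided.
    refine ⟨max 1 (‖θ‖ / ((1 + d) * (θ * a).re)), le_max_left _ _, fun z hz hn =>
      ⟨hsurj 0 z hz hn, fun p => ?_⟩⟩
    refine (norm_gauss_le_of_re_le ha (η := (1 + d) * (θ * a).re) (by positivity) hθ hθa2 ?_
      p).trans (mul_le_mul_of_nonneg_right (le_max_right _ _) (norm_nonneg _))
    push_cast at hz
    linarith
  | succ k ih =>
    obtain ⟨M, hM1, hM⟩ := ih
    set κ := min 1 (a ^ 2).re
    have hκ : 0 < κ := lt_min one_pos ha2
    refine ⟨max 1 (1 / d + 3 * (1 + ‖a‖) ^ 2 * M / κ * (1 + (1 + ‖a‖) / d)), le_max_left _ _,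
      fun z hz hn => ⟨hsurj (k + 1) z hz hn, fun p => ?_⟩⟩
    -- Shifting by 2a turns the eigenvalue of index n + 1 into that of index n; index 0 supplies the
    -- distance to a needed by the ladder step.
    obtain ⟨hw, hM'⟩ := hM (z - 2 * a) (by
      have e : (θ * (z - 2 * a)).re = (θ * z).re - 2 * (θ * a).re := by
        rw [mul_sub, Complex.sub_re, show θ * (2 * a) = ((2 : ℝ) : ℂ) * (θ * a) by push_cast; ring,
          Complex.re_ofReal_mul]
      rw [e]
      push_cast at hz
      linarith) (fun n hnk => by
      have := hn (n + 1) (by omega)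
      push_cast at this
      rwa [show z - 2 * a - a * (2 * n + 1) = z - a * (2 * (n + 1) + 1) by ring])
    refine (norm_gauss_le_ladder ha hκ (min_le_left _ _) (min_le_right _ _) hM' hM1 hw hd ?_
      p).trans (mul_le_mul_of_nonneg_right (le_max_right _ _) (norm_nonneg _))
    simpa using hn 0 (by omega)

end Estimates

/-! ### Closedness of the weak derivative and of the multiplication by `x` -/

section Resolvents

open Polynomial Filter Topology

lemma integral_smul_eq_inner {φ : ℝ → ℝ} (hφ : Continuous φ) (hc : HasCompactSupport φ) (f : L2) :
    ∫ x, φ x • f x = inner ℂ ((memLp_of_compactSupport hφ hc).toLp _ : L2) f := by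
  rw [L2.inner_def]
  refine integral_congr_ae ?_
  filter_upwards [(memLp_of_compactSupport hφ hc).coeFn_toLp] with x hx
  rw [RCLike.inner_apply, hx, Complex.conj_ofReal, Complex.real_smul, mul_comm]

lemma IsWeakDeriv.of_tendsto {f f' : L2} {u u' : ℕ → L2} (h : ∀ n, IsWeakDeriv (u n) (u' n))
    (hu : Tendsto u atTop (𝓝 f)) (hu' : Tendsto u' atTop (𝓝 f')) : IsWeakDeriv f f' := by
  intro φ hφ hc
  have hφ' : Continuous (deriv φ) := hφ.continuous_deriv (by simp)
  have h1 := fun n => h n φ hφ hc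
  simp only [integral_smul_eq_inner hφ' hc.deriv, integral_smul_eq_inner hφ.continuous hc]
    at h1 ⊢
  have h2 := (tendsto_const_nhds (x := ((memLp_of_compactSupport hφ' hc.deriv).toLp _ : L2))).inner
    (𝕜 := ℂ) hu
  have h3 := ((tendsto_const_nhds (x := ((memLp_of_compactSupport hφ.continuous hc).toLp _ :
    L2))).inner (𝕜 := ℂ) hu').neg
  simp only [h1] at h2
  exact tendsto_nhds_unique h2 h3

/-- Multiplication by x is closed: the factor x can be put on a compactly supported test function,
where L² convergence suffices. -/
lemma coe_eq_mul_of_tendsto {f y : L2} {u v : ℕ → L2}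
    (h : ∀ n, v n =ᵐ[volume] fun x : ℝ => (x : ℂ) * u n x)
    (hu : Tendsto u atTop (𝓝 f)) (hv : Tendsto v atTop (𝓝 y)) :
    y =ᵐ[volume] fun x : ℝ => (x : ℂ) * f x := by
  have hloc : LocallyIntegrable (fun x : ℝ => (x : ℂ) * f x) volume := by
    have := (locallyIntegrable_L2 f).locallyIntegrableOn Set.univ
    refine locallyIntegrableOn_univ.1 ?_
    exact this.continuousOn_mul Complex.continuous_ofReal.continuousOn isOpen_univ.isLocallyClosed
  have key : ∀ᵐ x, (y x - (x : ℂ) * f x) = 0 := by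
    refine ae_eq_zero_of_integral_contDiff_smul_eq_zero ((locallyIntegrable_L2 y).sub hloc) ?_
    intro φ hφ hc
    have hxc : HasCompactSupport fun x : ℝ => x * φ x := hc.mul_left
    have hxφ : Continuous fun x : ℝ => x * φ x := continuous_id.mul hφ.continuous
    have e : ∀ w : L2, (fun x : ℝ => φ x • ((x : ℂ) * w x)) = fun x => (x * φ x) • w x :=
      fun w => by
      ext x
      simp only [Complex.real_smul, Complex.ofReal_mul]
      ring
    have h1 : ∀ n, ∫ x, φ x • v n x = ∫ x, (x * φ x) • u n x := fun n => by
      rw [← e]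
      refine integral_congr_ae ?_
      filter_upwards [h n] with x hx
      rw [hx]
    simp only [integral_smul_eq_inner hφ.continuous hc, integral_smul_eq_inner hxφ hxc] at h1
    have h2 := (tendsto_const_nhds (x := ((memLp_of_compactSupport hφ.continuous hc).toLp _ :
      L2))).inner (𝕜 := ℂ) hv
    have h3 := (tendsto_const_nhds (x := ((memLp_of_compactSupport hxφ hxc).toLp _ : L2))).inner
      (𝕜 := ℂ) hu
    simp only [h1] at h2
    have h4 := tendsto_nhds_unique h2 h3
    rw [← integral_smul_eq_inner hφ.continuous hc, ← integral_smul_eq_inner hxφ hxc, ← e] at h4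
    simp only [smul_sub]
    rw [integral_sub (integrable_smul_L2 hφ.continuous hc y)
      (by rw [e]; exact integrable_smul_L2 hxφ hxc f), h4, sub_self]
  filter_upwards [key] with x hx
  exact sub_eq_zero.1 hx

/-! ### The resolvent of the oscillator -/

lemma quadForm_gauss {a : ℂ} (ha : 0 < a.re) (z : ℂ) (p : ℂ[X]) (g : formDomain) :
    inner ℂ (fderivative g) (gauss ha (dPoly a p)) + a ^ 2 * inner ℂ (mulX g) (gauss ha (X * p))
      = inner ℂ (g : L2) (gauss ha (oscPoly a z p) + z • gauss ha p) := by
  have h1 := congrArg conj (inner_gauss_dPoly ha (dPoly a p) (isWeakDeriv_fderivative g))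
  have h2 := congrArg conj (inner_gauss_X_mul ha (X * p) (mulX_coe g))
  rw [map_neg, inner_conj_symm, inner_conj_symm] at h1
  rw [inner_conj_symm, inner_conj_symm] at h2
  rw [oscPoly_eq, map_sub, map_add, map_neg, map_smul, map_smul, sub_add_cancel, inner_add_right,
    inner_neg_right, inner_smul_right, h1, h2, neg_neg]

lemma exists_tendsto_of_norm_le {E F G : Type*} [AddCommGroup E] [Module ℂ E]
    [NormedAddCommGroup F] [Module ℂ F] [NormedAddCommGroup G] [Module ℂ G] [CompleteSpace F]
    (T : E →ₗ[ℂ] F) (S : E →ₗ[ℂ] G) {C : ℝ} (h : ∀ p, ‖T p‖ ≤ C * ‖S p‖) {u : ℕ → E} {y : G}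
    (hu : Tendsto (fun n => S (u n)) atTop (𝓝 y)) : ∃ f, Tendsto (fun n => T (u n)) atTop (𝓝 f) := by
  refine cauchySeq_tendsto_of_complete (Metric.cauchySeq_iff'.2 fun ε hε => ?_)
  have hC : 0 < |C| + 1 := by positivity
  obtain ⟨N, hN⟩ := Metric.cauchySeq_iff'.1 hu.cauchySeq (ε / (|C| + 1)) (by positivity)
  refine ⟨N, fun n hn => ?_⟩
  have h1 := hN n hn
  rw [dist_eq_norm, ← map_sub, lt_div_iff₀ hC] at h1
  rw [dist_eq_norm, ← map_sub]
  refine (h _).trans_lt (lt_of_le_of_lt ?_ h1)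
  nlinarith [norm_nonneg (S (u n - u N)), le_abs_self C]

/-- `dPoly` as a linear map. -/
noncomputable def dPolyLinear (a : ℂ) : ℂ[X] →ₗ[ℂ] ℂ[X] where
  toFun := dPoly a
  map_add' p q := by simp only [dPoly, derivative_add]; ring
  map_smul' b p := by
    simp only [dPoly, smul_eq_C_mul, derivative_mul, derivative_C, RingHom.id_apply]; ring

/-- Approximate h by Gaussian functions and solve exactly for polynomials. The energy bound makes
solutions, derivatives and multiples by x all converge, and closedness carries the form identity to
the limit. -/
lemma exists_mem_oscillatorGraph {a : ℂ} (ha : 0 < a.re) (ha2 : 0 < (a ^ 2).re) {z : ℂ} {M : ℝ}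
    (hM0 : 0 ≤ M) (hz : Function.Surjective (oscPoly a z))
    (hM : ∀ p, ‖gauss ha p‖ ≤ M * ‖gauss ha (oscPoly a z p)‖) (h : L2) :
    ∃ f : L2, (f, h + z • f) ∈ oscillatorGraph (a ^ 2) ∧ ‖f‖ ≤ M * ‖h‖ := by
  obtain ⟨v, hv, hlim⟩ := mem_closure_iff_seq_limit.1 (dense_range_gauss ha h)
  choose q hq using hv
  choose p hp using fun n => hz (q n)
  have hS : Tendsto (fun n => (gauss ha ∘ₗ oscPoly a z) (p n)) atTop (𝓝 h) := by
    simpa [hp, hq] using hlim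
  have hκ : 0 < min 1 (a ^ 2).re := lt_min one_pos ha2
  have hE := energyNorm_le ha hκ (min_le_left _ _) (min_le_right _ _) hM hM0
  obtain ⟨f, hf⟩ := exists_tendsto_of_norm_le (gauss ha) (gauss ha ∘ₗ oscPoly a z) hM hS
  obtain ⟨f', hf'⟩ := exists_tendsto_of_norm_le (gauss ha ∘ₗ dPolyLinear a)
    (gauss ha ∘ₗ oscPoly a z) (fun p => (norm_gauss_dPoly_le ha p).trans (hE p)) hS
  obtain ⟨y, hy⟩ := exists_tendsto_of_norm_le (gauss ha ∘ₗ LinearMap.mulLeft ℂ X)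
    (gauss ha ∘ₗ oscPoly a z) (fun p => (norm_gauss_X_mul_le ha p).trans (hE p)) hS
  have hw : IsWeakDeriv f f' := IsWeakDeriv.of_tendsto (fun n => isWeakDeriv_gauss ha (p n)) hf hf'
  have hx := coe_eq_mul_of_tendsto (fun n => gauss_X_mul_coe ha (p n)) hf hy
  have hfV : f ∈ formDomain :=
    ⟨(mem_weakDeriv_domain_iff _).2 ⟨_, hw⟩, (memLp_congr_ae hx).1 (Lp.memLp _)⟩
  refine ⟨f, ⟨hfV, fun g => ?_⟩, le_of_tendsto_of_tendsto hf.norm (hS.norm.const_mul M)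
    (Eventually.of_forall fun n => hM (p n))⟩
  have e := L2.inner_def (𝕜 := ℂ) (g : L2) (h + z • f)
  simp only [RCLike.inner_apply] at e
  rw [quadForm_eq_inner, ← e, fderivative_eq_of_isWeakDeriv (f := ⟨f, hfV⟩) hw,
    mulX_eq_of_coe (f := ⟨f, hfV⟩) hx]
  have l1 := ((tendsto_const_nhds (x := fderivative g)).inner (𝕜 := ℂ) hf').add
    (((tendsto_const_nhds (x := mulX g)).inner (𝕜 := ℂ) hy).const_mul (a ^ 2))
  have l2 := (tendsto_const_nhds (x := (g : L2))).inner (𝕜 := ℂ) (hS.add (hf.const_smul z))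
  refine tendsto_nhds_unique l1 (l2.congr fun n => ?_)
  exact (quadForm_gauss ha z (p n) g).symm

lemma map_oscPoly (a z : ℂ) (p : ℂ[X]) :
    (oscPoly a z p).map (starRingEnd ℂ)
      = oscPoly (conj a) (conj z) (p.map (starRingEnd ℂ)) := by
  simp [oscPoly_apply, smul_eq_C_mul, derivative_map, map_ofNat]

/-- Testing with Gaussians of parameter conj a shows that f is orthogonal to the range of the
conjugate operator on them, which is dense since `oscPoly a z` is onto. -/
lemma eq_zero_of_mem_oscillatorGraph {a : ℂ} (ha : 0 < a.re) {z : ℂ}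
    (hz : Function.Surjective (oscPoly a z)) {f : L2}
    (hf : (f, z • f) ∈ oscillatorGraph (a ^ 2)) : f = 0 := by
  obtain ⟨hfV, H⟩ := hf
  set F : formDomain := ⟨f, hfV⟩
  have hā := conj_re_pos ha
  have h1 : ∀ p, inner ℂ (gauss hā (oscPoly (conj a) (conj z) p)) f = 0 := fun p => by
    set g : formDomain := ⟨gauss hā p, gauss_mem_formDomain hā p⟩
    have e := L2.inner_def (𝕜 := ℂ) (g : L2) (z • f)
    simp only [RCLike.inner_apply] at e
    have Hg := H g
    rw [← e, quadForm_eq_inner, fderivative_eq_of_isWeakDeriv (f := g) (isWeakDeriv_gauss hā p),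
      mulX_eq_of_coe (f := g) (gauss_X_mul_coe hā p), inner_smul_right] at Hg
    have h2 := inner_gauss_dPoly hā (dPoly (conj a) p) (isWeakDeriv_fderivative F)
    have h3 := inner_gauss_X_mul hā (X * p) (mulX_coe F)
    rw [oscPoly_eq, map_sub, map_add, map_neg, map_smul, map_smul, inner_sub_left,
      inner_add_left, inner_neg_left, inner_smul_left, inner_smul_left, h2, h3, map_pow,
      Complex.conj_conj, Complex.conj_conj, neg_neg]
    exact sub_eq_zero.2 Hg
  refine norm_le_zero_iff.1 (norm_le_of_forall_inner_gauss hā le_rfl fun q => ?_)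
  obtain ⟨p, hp⟩ := hz (q.map (starRingEnd ℂ))
  have h4 := h1 (p.map (starRingEnd ℂ))
  rw [← map_oscPoly, hp, map_conj_map_conj] at h4
  rw [h4]
  simp

lemma exists_isResolventAt {a : ℂ} (ha : 0 < a.re) (ha2 : 0 < (a ^ 2).re) {z : ℂ} {M : ℝ}
    (hM0 : 0 ≤ M) (hz : Function.Surjective (oscPoly a z))
    (hM : ∀ p, ‖gauss ha p‖ ≤ M * ‖gauss ha (oscPoly a z p)‖) :
    ∃ R : L2 →L[ℂ] L2, IsResolventAt (oscillator (a ^ 2)) z R ∧ ‖R‖ ≤ M := by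
  choose R hR hRM using exists_mem_oscillatorGraph ha ha2 hM0 hz hM
  have huniq : ∀ f h, (f, h + z • f) ∈ oscillatorGraph (a ^ 2) → R h = f := fun f h hf => by
    have h1 := sub_mem (hR h) hf
    have h2 : (R h - f, z • (R h - f)) ∈ oscillatorGraph (a ^ 2) := by
      convert h1 using 1
      rw [Prod.mk_sub_mk, smul_sub]
      congr 1
      abel
    exact sub_eq_zero.1 (eq_zero_of_mem_oscillatorGraph ha hz h2)
  let RL : L2 →ₗ[ℂ] L2 :=
    { toFun := R
      map_add' := fun h k => huniq _ _ (by
        convert add_mem (hR h) (hR k) using 1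
        rw [Prod.mk_add_mk, smul_add]
        congr 1
        abel)
      map_smul' := fun b h => huniq _ _ (by
        convert Submodule.smul_mem _ b (hR h) using 1
        rw [Prod.smul_mk, smul_add, RingHom.id_apply, smul_comm z b]) }
  refine ⟨RL.mkContinuous M hRM, ⟨fun h => ?_, fun f => ?_⟩,
    LinearMap.mkContinuous_norm_le _ hM0 _⟩
  · have h1 := hR h
    rw [← oscillator_graph, LinearPMap.mem_graph_iff] at h1
    obtain ⟨u, hu1, hu2⟩ := h1
    have hu1' : (u : L2) = R h := hu1
    have hmem : R h ∈ (oscillator (a ^ 2)).domain := hu1' ▸ u.2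
    refine ⟨hmem, ?_⟩
    have : (⟨R h, hmem⟩ : (oscillator (a ^ 2)).domain) = u := Subtype.ext hu1'.symm
    change oscillator (a ^ 2) ⟨R h, _⟩ - z • R h = h
    rw [this, hu2, add_sub_cancel_right]
  · change R _ = _
    refine huniq _ _ ?_
    rw [sub_add_cancel, ← oscillator_graph]
    exact LinearPMap.mem_graph _ f

lemma exists_isResolventAt_of_re_le {a : ℂ} (ha : 0 < a.re) (ha2 : 0 < (a ^ 2).re) {θ : ℂ}
    (hθ : 0 ≤ θ.re) (hθa2 : 0 ≤ (θ * a ^ 2).re) (hθa : 0 < (θ * a).re) {δ : ℝ} (hδ : 0 < δ)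
    (m : ℕ) :
    ∃ M : ℝ, 0 < M ∧ ∀ z : ℂ, (θ * z).re ≤ (2 * m + 3 - δ) * (θ * a).re →
      (∀ n ≤ m, δ ≤ ‖z - a * (2 * n + 1)‖) →
      ∃ R : L2 →L[ℂ] L2, IsResolventAt (oscillator (a ^ 2)) z R ∧ ‖R‖ ≤ M := by
  have hθ0 : 0 < ‖θ‖ := norm_pos_iff.2 fun h => by simp [h] at hθa
  -- The second term is the distance to λ_{m+1} that the half-plane itself guarantees.
  set d := min δ (δ * (θ * a).re / ‖θ‖) with hd
  have hd0 : 0 < d := lt_min hδ (by positivity)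
  -- With k = m + 2 the bound 2k - 1 - d is 2m + 3 - d, just short of λ_{m+1}; the price is that
  -- index m + 1 must be avoided too.
  obtain ⟨M, hM1, hM⟩ := exists_norm_gauss_le ha ha2 hθ hθa2 hθa hd0 (m + 2)
  refine ⟨M, by linarith, fun z hz hn => ?_⟩
  have key := hM z (hz.trans ?_) fun n hnm => ?_
  · exact exists_isResolventAt ha ha2 (by linarith) key.1 key.2
  · refine mul_le_mul_of_nonneg_right ?_ hθa.le
    push_cast
    linarith [min_le_left δ (δ * (θ * a).re / ‖θ‖)]
  · rcases Nat.lt_succ_iff_lt_or_eq.1 hnm with h | h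
    · exact (min_le_left _ _).trans (hn n (by omega))
    · refine (min_le_right _ _).trans ((div_le_iff₀ hθ0).2 ?_)
      have h3 := Complex.re_le_norm (θ * (a * (2 * n + 1) - z))
      rw [norm_mul, norm_sub_rev, mul_sub, Complex.sub_re, ← mul_assoc,
        show (2 * (n : ℂ) + 1) = ((2 * n + 1 : ℝ) : ℂ) by push_cast; ring,
        Complex.re_mul_ofReal] at h3
      rw [show (2 * (n : ℂ) + 1) = ((2 * n + 1 : ℝ) : ℂ) by push_cast; ring, mul_comm ‖_‖]
      refine le_trans ?_ h3
      rw [h]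
      push_cast
      linarith

end Resolvents

/-! ### The sector -/

/-- The second expression is ‖w‖ ‖c‖ sin (arg w - arg c), so its sign compares the two arguments. -/
lemma mem_sector {c w : ℂ} (hc_im : 0 < c.im) (h1 : 0 < w.im)
    (h2 : w.im * c.re - w.re * c.im < 0) : w ∈ sector 0 c.arg := by
  have hw : w ≠ 0 := fun h => by simp [h] at h1
  have hc0 : 0 ≤ c.arg := Complex.arg_nonneg_iff.2 hc_im.le
  have hw0 : 0 ≤ w.arg := Complex.arg_nonneg_iff.2 h1.le
  refine ⟨hw, hw0.lt_of_ne fun h => ?_, ?_⟩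
  · have := (Complex.arg_eq_zero_iff.1 h.symm).2
    linarith
  · by_contra hcon
    push Not at hcon
    have h3 : 0 ≤ Real.sin (w.arg - c.arg) :=
      Real.sin_nonneg_of_nonneg_of_le_pi (by linarith) (by linarith [Complex.arg_le_pi w])
    rw [Real.sin_sub] at h3
    have h4 : w.im * c.re - w.re * c.im = ‖w‖ * ‖c‖ *
        (Real.sin w.arg * Real.cos c.arg - Real.cos w.arg * Real.sin c.arg) := by
      have := Complex.norm_mul_cos_arg w
      have := Complex.norm_mul_sin_arg w
      have := Complex.norm_mul_cos_arg c
      have := Complex.norm_mul_sin_arg c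
      grind
    have := mul_nonneg (mul_nonneg (norm_nonneg w) (norm_nonneg c)) h3
    linarith

lemma sqrt_pos {c : ℂ} (hc_im : 0 < c.im) :
    0 < (c ^ (1 / 2 : ℂ)).re ∧ 0 < (c ^ (1 / 2 : ℂ)).im := by
  have hc : c ≠ 0 := fun h => by simp [h] at hc_im
  have harg0 : 0 < c.arg := (Complex.arg_nonneg_iff.2 hc_im.le).lt_of_ne fun h => by
    have := (Complex.arg_eq_zero_iff.1 h.symm).2
    linarith
  have hargpi := Complex.arg_le_pi c
  have hpi := Real.pi_pos
  have hargne : c.arg ≠ Real.pi := fun h => by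
    have := (Complex.arg_eq_pi_iff.1 h).2
    linarith
  have harg : c.arg < Real.pi := hargpi.lt_of_ne hargne
  have him : (Complex.log c * (1 / 2)).im = c.arg / 2 := by
    rw [show (1 / 2 : ℂ) = ((1 / 2 : ℝ) : ℂ) by push_cast; ring, Complex.im_mul_ofReal,
      Complex.log_im]
    ring
  rw [Complex.cpow_def_of_ne_zero hc, Complex.exp_re, Complex.exp_im, him]
  exact ⟨mul_pos (Real.exp_pos _) (Real.cos_pos_of_mem_Ioo ⟨by linarith, by linarith⟩),
    mul_pos (Real.exp_pos _) (Real.sin_pos_of_pos_of_lt_pi (by linarith) (by linarith))⟩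

end ComplexOscillator

/-! ### Conclusion: the two half-planes outside the sector. -/

theorem theoremt15 (c : ℂ) (hc_re : 0 < c.re) (hc_im : 0 < c.im) (δ : ℝ) (hδ0 : 0 < δ)
    (hδ1 : δ < 1) (m : ℕ) :
    ∃ ε : ℝ, 0 < ε ∧
      ComplexOscillator.pseudospectrum (ComplexOscillator.oscillator c) ε ⊆
        ((fun z : ℂ => z + (ComplexOscillator.eigval c (m + 1) - (δ : ℂ) * c ^ (1 / 2 : ℂ))) ''
            ComplexOscillator.sector 0 c.arg) ∪
          ⋃ n ∈ Set.Iic m, {z : ℂ | ‖z - ComplexOscillator.eigval c n‖ < δ} := by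
  open ComplexOscillator in
  obtain ⟨ha, hai⟩ := sqrt_pos hc_im
  have hac : (c ^ (1 / 2 : ℂ)) ^ 2 = c := by
    simp
  simp only [eigval]
  set a := c ^ (1 / 2 : ℂ)
  have hc_re' : c.re = a.re ^ 2 - a.im ^ 2 := by rw [← hac, sq, Complex.mul_re]; ring
  have hc_im' : c.im = 2 * a.re * a.im := by rw [← hac, sq, Complex.mul_im]; ring
  -- The choice θ = -i gives Re (θ z) = Im z, hence the half-plane below the horizontal edge.
  obtain ⟨M₁, hM₁, H₁⟩ := exists_isResolventAt_of_re_le (a := a) (θ := -Complex.I) ha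
    (by rwa [hac]) (by simp) (by simpa [hac] using hc_im.le) (by simpa using hai) hδ0 m
  -- The choice θ = i conj c makes Re (θ c) = 0, hence the half-plane bounded by the edge in
  -- direction c; here Re (θ a) = |a|² Im a.
  obtain ⟨M₂, hM₂, H₂⟩ := exists_isResolventAt_of_re_le (a := a)
    (θ := Complex.I * starRingEnd ℂ c) ha (by rwa [hac]) (by simpa using hc_im.le)
    (by rw [hac]; simp; linarith) (by
      simp only [Complex.mul_re, Complex.mul_im, Complex.I_re, Complex.I_im, Complex.conj_re,
        Complex.conj_im]
      rw [hc_re', hc_im']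
      have : 0 < a.im * (a.re ^ 2 + a.im ^ 2) := by positivity
      linarith) hδ0 m
  rw [hac] at H₁ H₂
  have hM : 0 < M₁ + M₂ := by positivity
  -- The extra 1 makes 1/ε strictly larger than any resolvent norm obtained below.
  refine ⟨1 / (M₁ + M₂ + 1), by positivity, fun z hz => ?_⟩
  by_contra hcon
  rw [Set.mem_union, not_or] at hcon
  obtain ⟨hz1, hz2⟩ := hcon
  have hdist : ∀ n ≤ m, δ ≤ ‖z - a * (2 * n + 1)‖ := fun n hn => by
    by_contra h
    exact hz2 (Set.mem_biUnion (Set.mem_Iic.2 hn) (not_le.1 h))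
  have hR : ∃ R : L2 →L[ℂ] L2, IsResolventAt (oscillator c) z R ∧ ‖R‖ ≤ M₁ + M₂ := by
    -- Position relative to the vertex of the sector: each half-plane condition becomes Re (θ w) ≤
    -- 0.
    set w := z - (a * (2 * ((m + 1 : ℕ) : ℂ) + 1) - δ * a) with hw
    have hzw : z = w + ((2 * m + 3 - δ : ℝ) : ℂ) * a := by rw [hw]; push_cast; ring
    have hre : ∀ θ : ℂ, (θ * z).re = (θ * w).re + (2 * m + 3 - δ) * (θ * a).re := fun θ => by
      rw [hzw, mul_add, Complex.add_re, mul_left_comm, Complex.re_ofReal_mul]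
    rcases le_or_gt w.im 0 with h1 | h1
    · obtain ⟨R, h3, h4⟩ := H₁ z (by
        rw [hre]
        have : (-Complex.I * w).re = w.im := by simp
        linarith) hdist
      exact ⟨R, h3, by linarith⟩
    · rcases lt_or_ge (w.im * c.re - w.re * c.im) 0 with h2 | h2
      · exact absurd ⟨w, mem_sector hc_im h1 h2, by simp [hw]⟩ hz1
      · obtain ⟨R, h3, h4⟩ := H₂ z (by
          rw [hre]
          have : (Complex.I * starRingEnd ℂ c * w).re = -(w.im * c.re - w.re * c.im) := by
            simp; ring
          linarith) hdist
        exact ⟨R, h3, by linarith⟩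
  obtain ⟨R, hR, hRM⟩ := hR
  rcases hz with hz | ⟨R', hR', hz⟩
  · exact hz ⟨R, hR⟩
  · rw [hR'.unique hR, one_div_one_div] at hz
    linarith
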